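/- Let $m,n,s,k,\lambda,t$ be positive integers such that $\lambda\mid 2nk$ and $t\mid \frac{2nk}{\lambda}$, put $v=\frac{2nk}{\lambda}+t$, and let $J$ be the subgroup of $\mathbb{Z}_v$ of order $t$. Let $A=(a_b)$ be a $\lambda$-fold Heffter array ${}^\lambda\mathrm{H}_t(m,n;s,k)$ over $\mathbb{Z}_v$ relative to $J$, that is, an $m\times n$ array with entries in $\mathbb{Z}_v$, some cells of which may be empty, such that each row has $s$ and each column has $k$ filled cells, the multiset $\{\pm x\mid x\in A\}$ contains each element of $\mathbb{Z}_v\setminus J$ exactly $\lambda$ times, and the elements of every row and of every column sum to $0$ in $\mathbb{Z}_v$. Let $\mathrm{skel}(A)$ be the set of filled cells. Let $\alpha_r$ be a permutation of $\mathrm{skel}(A)$ that acts on the filled cells of each row as a single cycle, and $\alpha_c$ one that acts on the filled cells of each column as a single cycle. Choosing a first cell $b$ in each row (column), $\alpha=\alpha_r$ ($\alpha=\alpha_c$) lists the entries of that row (column) as $(a_b,a_{\alpha(b)},a_{\alpha^2(b)},\dots)$; denote by $\omega_r$ and $\omega_c$ the resulting orderings of the rows and of the columns, and by $\omega_r^{-1}$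 the ordering that lists each row backwards. Assume that $\omega_r$ and $\omega_c$ are simple, i.e. for each row the partial sums $s_1,\dots,s_s$ of its list are pairwise distinct, and for each column the partial sums $s_1,\dots,s_k$ of its list are pairwise distinct, and that they are compatible, i.e. $\alpha_c\circ\alpha_r$ is a cycle of length $|\mathrm{skel}(A)|$. For such an ordering $\omega$ of the lines (rows or columns) of $A$, of length $\ell$, let $\mathcal{D}_\omega$ be the family of the $\ell$-cycles $(s_1+g,s_2+g,\dots,s_\ell+g)$ on the vertex set $\mathbb{Z}_v$, one for each line and each $g\in\mathbb{Z}_v$, where $s_1,\dots,s_\ell$ are the partial sums of that line. Let ${}^\lambda K$ be the multigraph obtained by repeating $\lambda$ times each edge of the complete multipartite graph on $\mathbb{Z}_v$ whose parts are the cosets of $J$. Then ${}^\lambda K$ is a ${}^\lambda K_{(\frac{2nk}{\lambda t}+1)\times t}$, that is, it has $\frac{2nk}{\lambda t}+1$ parts, each of size $t$; and, for a suitable choice of which of the parallel edges each cycle uses, $\mathcal{D}_{\omega_r^{-1}}$ and $\mathcal{D}_{\omega_c}$ are cycle decompositions of ${}^\lambda K$ (the edge sets of the cycles partition the edge set of ${}^\lambda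 K$; a $2$-cycle consists of two parallel edges), and there is a cellular biembedding of them into an orientable surface: there are a compact connected orientable surface $\Sigma$ without boundary and a continuous injective map $\psi:{}^\lambda K\to\Sigma$ from the topological multigraph such that every face (connected component of $\Sigma\setminus\psi({}^\lambda K)$) is homeomorphic to an open disc, and the faces can be coloured with two colours so that distinct faces whose boundaries share an edge have different colours, the faces of one colour correspond bijectively to the cycles of $\mathcal{D}_{\omega_r^{-1}}$ and those of the other colour to the cycles of $\mathcal{D}_{\omega_c}$, and the boundary of each face is the image under $\psi$ of the corresponding cycle. -/

import Mathlib

namespace HeffterBiembedding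

/-! ### Partially filled arrays and `λ`-fold relative Heffter arrays -/

/-- An `m × n` partially filled array with elements in `G`; `none` is an empty cell. -/
abbrev PFArray (m n : ℕ) (G : Type) := Matrix (Fin m) (Fin n) (Option G)

namespace PFArray

variable {m n : ℕ} {G : Type}

/-- The skeleton of `A`: the set of its filled cells. -/
abbrev Skel (A : PFArray m n G) : Type := {p : Fin m × Fin n // (A p.1 p.2).isSome = true}

/-- The element of `A` in a filled cell. -/
def entry (A : PFArray m n G) (b : A.Skel) : G := (A b.1.1 b.1.2).get b.2

/-- The row of a filled cell. -/
def row (A : PFArray m n G) (b : A.Skel) : Fin m := b.1.1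

/-- The column of a filled cell. -/
def col (A : PFArray m n G) (b : A.Skel) : Fin n := b.1.2

end PFArray

/-- `A` is a `λ`-fold Heffter array over `ℤ_v` relative to the subgroup `J` of order `t`, with
`v = 2nk/λ + t`, with `s` filled cells in each row and `k` filled cells in each column. -/
structure IsHeffterArray {m n v : ℕ} (lam t s k : ℕ) (J : AddSubgroup (ZMod v))
    (A : PFArray m n (ZMod v)) : Prop where
  lam_dvd : lam ∣ 2 * n * k
  t_dvd : t ∣ 2 * n * k / lam
  v_eq : v = 2 * n * k / lam + t
  card_J : Nat.card J = t
  row_filled : ∀ i, Fintype.card {b : A.Skel // A.row b = i} = s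
  col_filled : ∀ j, Fintype.card {b : A.Skel // A.col b = j} = k
  /-- the multiset `{±x ∣ x ∈ A}` contains `λ` times each element outside `J` -/
  count_eq : ∀ x : ZMod v, x ∉ J →
    ((Finset.univ : Finset A.Skel).val.map A.entry +
      (Finset.univ : Finset A.Skel).val.map (fun b => -A.entry b)).count x = lam
  row_sum : ∀ i, ∑ b : {b : A.Skel // A.row b = i}, A.entry b.1 = 0
  col_sum : ∀ j, ∑ b : {b : A.Skel // A.col b = j}, A.entry b.1 = 0

/-! ### Orderings of the lines of an array -/

/-- An ordering of each of the lines (rows, or columns) of a set `B` of cells, `line b` being the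
line of the cell `b`. It is given by a permutation of `B` that acts on each line as a cyclic
permutation (the successor of a cell in its line), and by the cell where each line begins. -/
structure LineOrdering {B ι : Type} (line : B → ι) where
  perm : Equiv.Perm B
  isCycleOn : ∀ i, perm.IsCycleOn {b | line b = i}
  start : ι → B
  line_start : ∀ i, line (start i) = i

namespace LineOrdering

variable {B ι G : Type} {line : B → ι} [AddCommGroup G]

/-- The reverse ordering: line `i`, listed as `b, α b, …, α⁻¹ b`, becomes `α⁻¹ b, …, α b, b`. -/
def inv (ω : LineOrdering line) : LineOrdering line where
  perm := ω.perm⁻¹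
  isCycleOn i := (ω.isCycleOn i).inv
  start i := ω.perm⁻¹ (ω.start i)
  line_start i := by
    have h := (ω.isCycleOn i).inv.1.mapsTo (show ω.start i ∈ {b | line b = i} from ω.line_start i)
    exact h

/-- The `j`-th partial sum of the ordered list `a (b), a (α b), a (α² b), …` of line `i`. -/
def partialSum (ω : LineOrdering line) (a : B → G) (i : ι) (j : ℕ) : G :=
  ∑ l ∈ Finset.range j, a ((ω.perm ^ l) (ω.start i))

/-- The ordering is simple: on every line, of length `ℓ`, the partial sums `s₁, …, s_ℓ` are
pairwise distinct. -/
def IsSimple (ω : LineOrdering line) (a : B → G) (ℓ : ℕ) : Prop :=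
  ∀ i, Set.InjOn (ω.partialSum a i) (Set.Icc 1 ℓ)

/-- The cycles of the decomposition `D_ω`, as cyclic sequences of vertices: they are indexed by
the lines `i` and the elements `g` of the group, and the cycle with index `(i, g)` is the
translate `(s₁ + g, …, s_ℓ + g)` of the sequence of partial sums of line `i`. -/
def cycleVertices (ω : LineOrdering line) (a : B → G) (ℓ : ℕ) (p : ι × G) (j : Fin ℓ) : G :=
  ω.partialSum a p.1 (j + 1) + p.2

end LineOrdering

/-- Row and column orderings are compatible if `α_c ∘ α_r` is a cycle of length `|skel A|`. -/
def Compatible {m n : ℕ} {G : Type} {A : PFArray m n G} (ωr : LineOrdering A.row)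
    (ωc : LineOrdering A.col) : Prop :=
  (ωc.perm * ωr.perm).IsCycle ∧ (ωc.perm * ωr.perm).support.card = Fintype.card A.Skel

/-! ### Multigraphs `^λΓ`, their cycles and their topology -/

/-- The complete multipartite graph on the group `G` whose parts are the cosets of `J`. -/
def cosetGraph {G : Type} [AddCommGroup G] (J : AddSubgroup G) : SimpleGraph G where
  Adj x y := x - y ∉ J
  symm := ⟨fun x y h h' => h (by simpa using J.neg_mem h')⟩
  loopless := ⟨fun x h => h (by simp)⟩

section Multigraph

variable {V : Type}

/-- The directed edges of the multigraph `^λΓ` obtained by repeating each edge of `Γ` `λ` times.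
The undirected edge underlying `d` is `(d.1.edge, d.2)`. -/
abbrev MultiDart (Γ : SimpleGraph V) (lam : ℕ) : Type := Γ.Dart × Fin lam

/-- A cycle of length `ℓ` in `^λΓ`, traversed in one direction from one of its vertices. For
`ℓ = 2` it consists of two parallel edges. -/
structure MultiCycle (Γ : SimpleGraph V) (lam ℓ : ℕ) where
  two_le : 2 ≤ ℓ
  dart : Fin ℓ → MultiDart Γ lam
  closed : ∀ j, (dart j).1.snd = (dart (finRotate ℓ j)).1.fst
  vertex_injective : Function.Injective fun j => (dart j).1.fst
  edge_injective : Function.Injective fun j => ((dart j).1.edge, (dart j).2)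

/-- The vertices of a cycle, in cyclic order. -/
def MultiCycle.vertex {Γ : SimpleGraph V} {lam ℓ : ℕ} (C : MultiCycle Γ lam ℓ) (j : Fin ℓ) : V :=
  (C.dart j).1.fst

/-- A family of `ℓ`-cycles of `^λΓ` whose edge-sets partition the edge-set of `^λΓ`. -/
def IsCycleDecomposition {Γ : SimpleGraph V} {lam ℓ : ℕ} {I : Type}
    (D : I → MultiCycle Γ lam ℓ) : Prop :=
  ∀ e ∈ Γ.edgeSet, ∀ c : Fin lam,
    ∃! p : I × Fin ℓ, (((D p.1).dart p.2).1.edge, ((D p.1).dart p.2).2) = (e, c)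

/-- The gluing that produces the topological multigraph `^λΓ` from isolated points, one for each
vertex, and unit intervals, one for each directed edge: the interval of `d` begins at the first
vertex of `d`, and opposite directed edges carry the same segment, run in opposite directions. -/
inductive Glue (Γ : SimpleGraph V) (lam : ℕ) :
    (Σ _ : V, Unit) ⊕ (Σ _ : MultiDart Γ lam, unitInterval) →
      (Σ _ : V, Unit) ⊕ (Σ _ : MultiDart Γ lam, unitInterval) → Prop
  | source (d : MultiDart Γ lam) : Glue Γ lam (Sum.inr ⟨d, 0⟩) (Sum.inl ⟨d.1.fst, ()⟩)
  | flip (d : MultiDart Γ lam) (r : unitInterval) :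
      Glue Γ lam (Sum.inr ⟨d, r⟩) (Sum.inr ⟨(d.1.symm, d.2), unitInterval.symm r⟩)

/-- The multigraph `^λΓ` as a topological space. -/
def Realization (Γ : SimpleGraph V) (lam : ℕ) : Type := Quot (Glue Γ lam)

instance (Γ : SimpleGraph V) (lam : ℕ) : TopologicalSpace (Realization Γ lam) :=
  inferInstanceAs (TopologicalSpace (Quot (Glue Γ lam)))

/-- The closed segment of an edge in the topological multigraph. -/
def edgeArc {Γ : SimpleGraph V} {lam : ℕ} (d : MultiDart Γ lam) : Set (Realization Γ lam) :=
  Set.range fun r : unitInterval => Quot.mk (Glue Γ lam) (Sum.inr ⟨d, r⟩)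

/-- The closed curve formed by the edges of a cycle in the topological multigraph. -/
def MultiCycle.carrier {Γ : SimpleGraph V} {lam ℓ : ℕ} (C : MultiCycle Γ lam ℓ) :
    Set (Realization Γ lam) :=
  ⋃ j, edgeArc (C.dart j)

end Multigraph

/-! ### Surfaces and embeddings -/

open scoped ContDiff in
/-- `S` is an orientable (closed, connected) surface: it is compact, connected and Hausdorff, and
has an atlas of charts in the plane `ℂ = ℝ²` whose transition maps are smooth with positive
Jacobian determinant. -/
structure IsOrientableSurface (S : Type) [TopologicalSpace S] : Prop where
  t2 : T2Space S
  compact : CompactSpace S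
  connected : ConnectedSpace S
  exists_oriented_atlas : ∃ atl : Set (OpenPartialHomeomorph S ℂ),
    (∀ p : S, ∃ e ∈ atl, p ∈ e.source) ∧
    ∀ e ∈ atl, ∀ e' ∈ atl,
      ContDiffOn ℝ ∞ (e.symm.trans e') (e.symm.trans e').source ∧
      ∀ z ∈ (e.symm.trans e').source, 0 < (fderiv ℝ (e.symm.trans e') z).det

section Embedding

variable {V S : Type} [TopologicalSpace S] {Γ : SimpleGraph V} {lam : ℕ}

/-- An embedding of the multigraph `^λΓ` in `S`. -/
def IsGraphEmbedding (ψ : Realization Γ lam → S) : Prop :=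
  Continuous ψ ∧ Function.Injective ψ

/-- The faces of an embedding: the connected components of the complement of its image. -/
def IsFace (ψ : Realization Γ lam → S) (F : Set S) : Prop :=
  ∃ x ∈ (Set.range ψ)ᶜ, F = connectedComponentIn (Set.range ψ)ᶜ x

/-- Each face is homeomorphic to an open disc. -/
def IsCellular (ψ : Realization Γ lam → S) : Prop :=
  ∀ F, IsFace ψ F → Nonempty (F ≃ₜ Metric.ball (0 : ℂ) 1)

/-- `ψ` is a biembedding of two cycle decompositions `D` and `D'` of `^λΓ`: an embedding whose
faces can be coloured with two colours, distinct faces whose boundaries share an edge having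
different colours, in such a way that the faces of one colour are bounded by the cycles of `D`
and those of the other colour by the cycles of `D'`, each cycle bounding one face. -/
def IsBiembedding {ℓ ℓ' : ℕ} {I I' : Type} (ψ : Realization Γ lam → S)
    (D : I → MultiCycle Γ lam ℓ) (D' : I' → MultiCycle Γ lam ℓ') : Prop :=
  IsCycleDecomposition D ∧ IsCycleDecomposition D' ∧ IsGraphEmbedding ψ ∧
  ∃ color : Set S → Bool,
    (∀ F F', IsFace ψ F → IsFace ψ F' → F ≠ F' → ∀ d : MultiDart Γ lam,
      ψ '' edgeArc d ⊆ frontier F → ψ '' edgeArc d ⊆ frontier F' → color F ≠ color F') ∧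
    (∃ f : I → Set S, Set.BijOn f Set.univ {F | IsFace ψ F ∧ color F = true} ∧
      ∀ i, frontier (f i) = ψ '' (D i).carrier) ∧
    (∃ f : I' → Set S, Set.BijOn f Set.univ {F | IsFace ψ F ∧ color F = false} ∧
      ∀ i, frontier (f i) = ψ '' (D' i).carrier)

end Embedding

end HeffterBiembedding

/-! Take one directed edge `(b, x)`, from `x` to `x + a_b`, for each filled cell `b` and each `x` in
`ℤ_v`. The edges over a pair `{x, y}` of distinct cosets are those leaving `x` with entry `y - x`
and those leaving `y` with entry `x - y`; their number is the multiplicity of `y - x` in `{±a}`,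
namely `λ`. So these edges can be labelled as the edges of `^λK`, each once
(`IsHeffterArray.card_fiber`, `nonempty_edgeLabelling`).

Following an edge by the next entry of its column, or of its reversed row, gives two permutations of
the edges. Lines sum to zero and the orderings are simple, so the orbits are the cycles of the two
families, and each edge lies on exactly one cycle of each family. Glue a disc along every cycle.
Going back along a reversed row and then forward along a column takes `(b, x)` to `(α_c (α_r b),
x)`. Compatibility makes this one cyclic order of all edges leaving `x`, so the faces at `x` close
up to a single disc and the result is a surface. It is orientable, because each edge is followed in
its own direction by one face of each colour.

This surface is built concretely from `CellData`. Every edge receives a lozenge `[-1, 1] × [0, 1]`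
made of the edge and one triangular sector of each adjacent face. The lozenges are mapped into a
product of real and complex coordinates, where `point_eq_of_rel` and `rel_of_point_eq` show that the
points which coincide are exactly those prescribed by `Rel`. Hausdorffness is then inherited and
compactness follows from finiteness.

The oriented atlas comes from a branched covering of the sphere: `developing` sends all vertices to
`1`, all edges to the unit circle, and the centres of the faces to `0` or `∞` according to colour.
In suitable disc coordinates `w` it reads `w ^ n` or `w ^ (-n)` on an `n`-gonal face and `exp (4 * w
^ N)` around a vertex. The centre of a chart lies in no other chart, so transition maps intertwine
holomorphic maps at noncritical points; they are holomorphic with nonzero derivative, hence smooth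
and orientation preserving. The complement of the edges is the disjoint union of the open faces,
which yields the faces, their boundaries and their colours. -/

namespace HeffterBiembedding

open Set Metric

/-! ### Charts from quotient maps, and holomorphic changes of coordinates -/

section Charts

/-- A map that factors a continuous map through a continuous map from a compact space is
continuous on the range of the latter. -/
theorem continuousOn_range_of_comp_eq {κ Y Z : Type*} [TopologicalSpace κ] [CompactSpace κ]
    [TopologicalSpace Y] [T2Space Y] [TopologicalSpace Z] {p : κ → Y} {h : κ → Z} {c : Y → Z}
    (hp : Continuous p) (hh : Continuous h) (hc : ∀ a, c (p a) = h a) :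
    ContinuousOn c (range p) := by
  rw [continuousOn_iff_isClosed]
  intro t ht
  -- A continuous map from a compact space to a Hausdorff space is closed.
  refine ⟨p '' (h ⁻¹' t), ((ht.preimage hh).isCompact.image hp).isClosed, ?_⟩
  ext y
  constructor
  · rintro ⟨hy, a, rfl⟩
    exact ⟨⟨a, by simpa [hc] using hy, rfl⟩, a, rfl⟩
  · rintro ⟨⟨a, ha, rfl⟩, -⟩
    exact ⟨by simpa [hc] using ha, a, rfl⟩

/-- Two continuous maps `p` and `h` with the same fibres on a compact space, the second one onto a
neighbourhood of the open unit disc, give a chart of the target of `p`. -/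
theorem exists_disc_chart {κ S : Type*} [TopologicalSpace κ] [CompactSpace κ] [TopologicalSpace S]
    [T2Space S] {p : κ → S} {h : κ → ℂ} (hp : Continuous p) (hh : Continuous h)
    (hker : ∀ a b, p a = p b ↔ h a = h b) (hball : ball 0 1 ⊆ range h)
    (hopen : IsOpen (p '' (h ⁻¹' ball 0 1))) :
    ∃ c : OpenPartialHomeomorph S ℂ, c.source = p '' (h ⁻¹' ball 0 1) ∧ c.target = ball 0 1 ∧
      ∀ a, c (p a) = h a := by
  obtain ⟨a₀, -⟩ : (0 : ℂ) ∈ range h := hball (by simp)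
  have h1 : ∀ a, Function.extend p h (fun _ => 0) (p a) = h a := fun a =>
    Function.FactorsThrough.extend_apply (fun a b hab => (hker a b).1 hab) _ _
  have h2 : ∀ a, Function.extend h p (fun _ => p a₀) (h a) = p a := fun a =>
    Function.FactorsThrough.extend_apply (fun a b hab => (hker a b).2 hab) _ _
  refine ⟨{ toFun := Function.extend p h (fun _ => 0)
            invFun := Function.extend h p (fun _ => p a₀)
            source := p '' (h ⁻¹' ball 0 1)
            target := ball 0 1
            map_source' := ?_, map_target' := ?_, left_inv' := ?_, right_inv' := ?_
            open_source := hopen, open_target := isOpen_ball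
            continuousOn_toFun := (continuousOn_range_of_comp_eq hp hh h1).mono
              (image_subset_range _ _)
            continuousOn_invFun := (continuousOn_range_of_comp_eq hh hp h2).mono hball },
    rfl, rfl, h1⟩
  · rintro _ ⟨a, ha, rfl⟩
    rw [h1]
    exact ha
  · intro w hw
    obtain ⟨a, rfl⟩ := hball hw
    exact ⟨a, hw, (h2 a).symm⟩
  · rintro _ ⟨a, ha, rfl⟩
    simp only [h1, h2]
  · intro w hw
    obtain ⟨a, rfl⟩ := hball hw
    simp only [h1, h2]

theorem det_restrictScalars_toSpanSingleton (a : ℂ) :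
    ((ContinuousLinearMap.toSpanSingleton ℂ a).restrictScalars ℝ).det = Complex.normSq a := by
  have : (((ContinuousLinearMap.toSpanSingleton ℂ a).restrictScalars ℝ : ℂ →L[ℝ] ℂ) : ℂ →ₗ[ℝ] ℂ)
      = (LinearMap.mul ℝ ℂ a) := by
    ext
    simp [mul_comm]
  rw [ContinuousLinearMap.det, this]
  rw [← Algebra.norm_complex_apply, Algebra.norm_apply]
  rfl

open scoped ContDiff in
/-- A change of coordinates that intertwines two holomorphic maps without critical points is smooth
and preserves the orientation. -/
theorem contDiffOn_det_pos_of_comp_eq (T : OpenPartialHomeomorph ℂ ℂ) {F F' : ℂ → ℂ}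
    (hF : ∀ w ∈ T.source, ∃ a ≠ 0, HasStrictDerivAt F a w)
    (hF' : ∀ w ∈ T.source, ∃ a ≠ 0, HasStrictDerivAt F' a (T w))
    (hc : ∀ w ∈ T.source, F' (T w) = F w) :
    ContDiffOn ℝ ∞ T T.source ∧ ∀ z ∈ T.source, 0 < (fderiv ℝ T z).det := by
  have key : ∀ w ∈ T.source, ∃ a ≠ 0, HasDerivAt T a w := by
    intro w hw
    obtain ⟨a, ha, hFa⟩ := hF w hw
    obtain ⟨b, hb, hFb⟩ := hF' w hw
    have hcont : ContinuousAt T w := T.continuousAt hw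
    have hev := hcont.eventually (hFb.eventually_left_inverse hb)
    have hsrc := T.open_source.mem_nhds hw
    have hinv := (hFb.to_localInverse hb).hasDerivAt
    rw [hc w hw] at hinv
    -- Near `w`, `T` is the local inverse of `F'` composed with `F`; continuity of `T` keeps its
    -- values in the domain of that inverse.
    refine ⟨b⁻¹ * a, mul_ne_zero (inv_ne_zero hb) ha, ?_⟩
    refine (hinv.comp w hFa.hasDerivAt).congr_of_eventuallyEq ?_
    filter_upwards [hev, hsrc] with z hz hzs
    rw [Function.comp_apply, ← hc z hzs, hz]
  constructor
  · have hd : DifferentiableOn ℂ T T.source := fun w hw => by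
      obtain ⟨a, -, h⟩ := key w hw
      exact h.differentiableAt.differentiableWithinAt
    -- Complex differentiability on an open set already gives smoothness.
    exact (hd.contDiffOn T.open_source).restrict_scalars ℝ
  · intro z hz
    obtain ⟨a, ha, h⟩ := key z hz
    rw [(h.hasFDerivAt.restrictScalars ℝ).fderiv, det_restrictScalars_toSpanSingleton]
    exact Complex.normSq_pos.2 ha

-- Treated apart from the transitions between distinct charts, because the map to the sphere may be
-- critical at the centre of a chart; here the identity is intertwined with itself.
open scoped ContDiff in
theorem contDiffOn_det_pos_symm_trans_self {S : Type*} [TopologicalSpace S]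
    (c : OpenPartialHomeomorph S ℂ) :
    ContDiffOn ℝ ∞ (c.symm.trans c) (c.symm.trans c).source ∧
      ∀ z ∈ (c.symm.trans c).source, 0 < (fderiv ℝ (c.symm.trans c) z).det := by
  refine contDiffOn_det_pos_of_comp_eq _ (F := id) (F' := id) ?_ ?_ ?_
  · exact fun w _ => ⟨1, one_ne_zero, hasStrictDerivAt_id _⟩
  · exact fun w _ => ⟨1, one_ne_zero, hasStrictDerivAt_id _⟩
  · intro w hw
    simp only [OpenPartialHomeomorph.trans_source, OpenPartialHomeomorph.symm_source, mem_inter_iff] at hw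
    simpa using c.right_inv hw.1

end Charts

/-! ### Polar coordinates on a disc cut into sectors -/

section Polar

/-- Polar coordinates on the disc divided into `n` sectors. -/
noncomputable def polar (n : ℕ) (j : ℕ) (t φ : ℝ) : ℂ :=
  t * Complex.exp (2 * Real.pi * Complex.I * ((j + φ) / n : ℝ))

theorem continuous_polar {n : ℕ} {j : ℕ} {α : Type*} [TopologicalSpace α] {t φ : α → ℝ}
    (ht : Continuous t) (hφ : Continuous φ) : Continuous fun a => polar n j (t a) (φ a) := by
  unfold polar
  fun_prop

theorem polar_pow {n : ℕ} (hn : n ≠ 0) (j : ℕ) (t φ : ℝ) :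
    polar n j t φ ^ n = t ^ n * Complex.exp (2 * Real.pi * Complex.I * φ) := by
  have hn' : (n : ℂ) ≠ 0 := by exact_mod_cast hn
  rw [polar, mul_pow, ← Complex.exp_nat_mul]
  congr 1
  rw [Complex.exp_eq_exp_iff_exists_int]
  refine ⟨j, ?_⟩
  push_cast
  field_simp
  ring

theorem norm_polar {n : ℕ} (j : ℕ) {t : ℝ} (ht : 0 ≤ t) (φ : ℝ) : ‖polar n j t φ‖ = t := by
  have : (2 * Real.pi * Complex.I * ((j + φ) / n : ℝ) : ℂ)
      = ((2 * Real.pi * ((j + φ) / n) : ℝ) : ℂ) * Complex.I := by push_cast; ring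
  rw [polar, norm_mul, this, Complex.norm_exp_ofReal_mul_I, mul_one, Complex.norm_real,
    Real.norm_of_nonneg ht]

/-- Equal, or consecutive, positions on a circle divided into `n` arcs. -/
def SamePosition {n : ℕ} [NeZero n] (j : Fin n) (φ : ℝ) (j' : Fin n) (φ' : ℝ) : Prop :=
  (j = j' ∧ φ = φ') ∨ (φ = 1 ∧ φ' = 0 ∧ j' = j + 1) ∨ (φ = 0 ∧ φ' = 1 ∧ j = j' + 1)

theorem polar_succ {n : ℕ} [NeZero n] (j : Fin n) (t : ℝ) :
    polar n (j + 1 : Fin n) t 0 = polar n j t 1 := by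
  have hn' : (n : ℂ) ≠ 0 := by exact_mod_cast NeZero.ne n
  unfold polar
  congr 1
  rw [Complex.exp_eq_exp_iff_exists_int]
  have h : ((j + 1 : Fin n) : ℕ) = ((j : ℕ) + 1) % n := by
    rw [Fin.val_add]; simp
  have h2 := Nat.div_add_mod ((j : ℕ) + 1) n
  rw [← h] at h2
  generalize ((j : ℕ) + 1) / n = q at h2
  -- `q` is `1` when `j` is the last sector and `0` otherwise.
  refine ⟨-(q : ℤ), ?_⟩
  have h3 : (n : ℂ) * q + ((j + 1 : Fin n) : ℕ) = (j : ℕ) + 1 := by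
    exact_mod_cast h2
  have h4 : (((j + 1 : Fin n) : ℕ) : ℂ) = (j : ℕ) + 1 - (n : ℂ) * q := by
    rw [← h3]; ring
  push_cast
  rw [h4]
  field_simp
  ring

theorem SamePosition.polar_eq {n : ℕ} [NeZero n] {j j' : Fin n} {φ φ' : ℝ}
    (h : SamePosition j φ j' φ') (t : ℝ) : polar n j t φ = polar n j' t φ' := by
  rcases h with ⟨rfl, rfl⟩ | ⟨rfl, rfl, rfl⟩ | ⟨rfl, rfl, rfl⟩
  · rfl
  · rw [polar_succ]
  · rw [polar_succ]

/-- Equality of the exponentials makes `j + φ` and `j' + φ'` congruent modulo `n`. Hence `φ - φ'` is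
an integer between `-1` and `1`, and its three values are the three cases. -/
theorem samePosition_of_polar_eq {n : ℕ} [NeZero n] {j j' : Fin n} {φ φ' t : ℝ}
    (hφ : φ ∈ Icc (0 : ℝ) 1) (hφ' : φ' ∈ Icc (0 : ℝ) 1) (ht : t ≠ 0)
    (h : polar n j t φ = polar n j' t φ') : SamePosition j φ j' φ' := by
  have hn : (n : ℝ) ≠ 0 := by exact_mod_cast NeZero.ne n
  have hn0 : (0 : ℝ) < n := by exact_mod_cast NeZero.pos n
  have h1 := mul_left_cancel₀ (by exact_mod_cast ht) h
  rw [Complex.exp_eq_exp_iff_exists_int] at h1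
  obtain ⟨q, hq⟩ := h1
  have hpi : (2 * Real.pi * Complex.I : ℂ) ≠ 0 := Complex.two_pi_I_ne_zero
  have h2 : ((((j : ℕ) + φ) / n : ℝ) : ℂ) = ((((j' : ℕ) + φ') / n : ℝ) : ℂ) + q := by
    apply mul_left_cancel₀ hpi
    rw [hq]; ring
  have h3 : ((j : ℕ) + φ) / n = ((j' : ℕ) + φ') / n + q := by exact_mod_cast h2
  have h4 : (j : ℕ) + φ = (j' : ℕ) + φ' + q * n := by
    field_simp at h3
    linarith
  obtain ⟨z, hz⟩ : ∃ z : ℤ, φ - φ' = z := ⟨(j' : ℕ) - (j : ℕ) + q * n, by push_cast; linarith⟩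
  have hz1 : z ≤ 1 := by
    have : (z : ℝ) ≤ 1 := by rw [← hz]; linarith [hφ.2, hφ'.1]
    exact_mod_cast this
  have hz2 : -1 ≤ z := by
    have : (-1 : ℝ) ≤ z := by rw [← hz]; linarith [hφ.1, hφ'.2]
    exact_mod_cast this
  have h5 : ((j : ℕ) : ℤ) + z = (j' : ℕ) + q * n := by
    have : ((j : ℕ) : ℝ) + z = (j' : ℕ) + q * n := by rw [← hz]; linarith
    exact_mod_cast this
  have fin_eq : ∀ (a : ℕ) (b : Fin n) (q : ℤ), ((a : ℕ) : ℤ) = (b : ℕ) + q * n →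
      (b : ℕ) = a % n := by
    intro a b q hab
    have : ((b : ℕ) : ℤ) % n = (a : ℤ) % n := by rw [hab]; simp
    have h' : (b : ℕ) % n = a % n := by exact_mod_cast this
    rw [← h', Nat.mod_eq_of_lt b.2]
  obtain rfl | rfl | rfl : z = 0 ∨ z = 1 ∨ z = -1 := by omega
  · left
    refine ⟨?_, by push_cast at hz; linarith⟩
    have := fin_eq j j' q (by linarith)
    rw [Nat.mod_eq_of_lt j.2] at this
    exact Fin.ext this.symm
  · right; left
    push_cast at hz
    refine ⟨by linarith [hφ.2, hφ'.1], by linarith [hφ.2, hφ'.1], ?_⟩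
    have := fin_eq (j + 1) j' q (by push_cast; linarith)
    refine Fin.ext (this.trans ?_)
    rw [Fin.val_add]
    simp
  · right; right
    push_cast at hz
    refine ⟨by linarith [hφ.1, hφ'.2], by linarith [hφ.1, hφ'.2], ?_⟩
    have := fin_eq (j' + 1) j (-q) (by push_cast; linarith)
    refine Fin.ext (this.trans ?_)
    rw [Fin.val_add]
    simp

theorem exists_polar_eq {n : ℕ} [NeZero n] (w : ℂ) :
    ∃ (j : Fin n) (φ : ℝ), φ ∈ Icc (0 : ℝ) 1 ∧ polar n j ‖w‖ φ = w := by
  have hn : (n : ℝ) ≠ 0 := by exact_mod_cast NeZero.ne n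
  set a : ℝ := w.arg / (2 * Real.pi) * n with ha
  refine ⟨⟨(⌊a⌋ % n).toNat, ?_⟩, Int.fract a, ⟨Int.fract_nonneg _, (Int.fract_lt_one _).le⟩, ?_⟩
  · have := Int.emod_lt_of_pos ⌊a⌋ (show (0 : ℤ) < n by exact_mod_cast NeZero.pos n)
    have := Int.emod_nonneg ⌊a⌋ (show (n : ℤ) ≠ 0 by exact_mod_cast NeZero.ne n)
    omega
  · conv_rhs => rw [← Complex.norm_mul_exp_arg_mul_I w]
    unfold polar
    congr 1
    rw [Complex.exp_eq_exp_iff_exists_int]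
    refine ⟨-(⌊a⌋ / n), ?_⟩
    have h0 := Int.emod_nonneg ⌊a⌋ (show (n : ℤ) ≠ 0 by exact_mod_cast NeZero.ne n)
    have h1 : (((⌊a⌋ % n).toNat : ℕ) : ℝ) = ⌊a⌋ - n * ((⌊a⌋ / n : ℤ) : ℝ) := by
      have h2 : (((⌊a⌋ % n).toNat : ℕ) : ℤ) = ⌊a⌋ - n * (⌊a⌋ / n) := by
        rw [Int.toNat_of_nonneg h0, Int.emod_def]
      exact_mod_cast h2
    have h3 : (((⌊a⌋ % n).toNat : ℕ) + Int.fract a : ℝ) / n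
        = w.arg / (2 * Real.pi) - ((⌊a⌋ / n : ℤ) : ℝ) := by
      rw [h1, Int.fract]
      field_simp
      rw [ha]
      field_simp
      ring
    simp only
    rw [h3]
    have hpi : (Real.pi : ℂ) ≠ 0 := by exact_mod_cast Real.pi_ne_zero
    push_cast
    field_simp
    ring

end Polar

/-! ### The surface glued from lozenges -/

/-- Gluing data of an oriented surface whose faces are coloured with two colours: directed edges
`E` on a vertex set `V`, the cyclic sequence of edges of each face of each colour, and the cyclic
sequence of the edges that leave each vertex. Each edge is followed in its direction by its two
faces, and turning around a vertex crosses faces of alternating colours. -/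
structure CellData (V E : Type) (Face : Bool → Type) (len : Bool → ℕ) (N : ℕ)
    [∀ c, NeZero (len c)] [NeZero N] where
  src : E → V
  tgt : E → V
  src_ne_tgt : ∀ e, src e ≠ tgt e
  next : Bool → Equiv.Perm E
  src_next : ∀ c e, src (next c e) = tgt e
  faceEdge : ∀ c, Face c × Fin (len c) ≃ E
  faceEdge_succ : ∀ c F j, faceEdge c (F, j + 1) = next c (faceEdge c (F, j))
  src_faceEdge_injective : ∀ c F, Function.Injective fun j => src (faceEdge c (F, j))
  outEdge : V × Fin N ≃ E
  src_outEdge : ∀ x i, src (outEdge (x, i)) = x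
  outEdge_succ : ∀ x i, outEdge (x, i + 1) = next false ((next true).symm (outEdge (x, i)))

/-- The side of an edge on which its face of a given colour lies. -/
def sgn (c : Bool) : ℝ := if c then -1 else 1

theorem sgn_mul_self (c : Bool) : sgn c * sgn c = 1 := by cases c <;> simp [sgn]

theorem sgn_ne_zero (c : Bool) : sgn c ≠ 0 := by cases c <;> simp [sgn]

theorem eq_of_sgn_mul_pos {c c' : Bool} {y : ℝ} (h : 0 < sgn c * y) (h' : 0 < sgn c' * y) :
    c = c' := by
  cases c <;> cases c' <;> simp [sgn] at h h' ⊢ <;> linarith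

theorem exists_sgn_mul_pos {y : ℝ} (h : y ≠ 0) : ∃ c, 0 < sgn c * y := by
  rcases lt_or_gt_of_ne h with h | h
  · exact ⟨true, by simp [sgn]; exact h⟩
  · exact ⟨false, by simp [sgn]; exact h⟩

/-- The distance from an edge into the face of colour `c`. -/
noncomputable def depth (c : Bool) (y : ℝ) : ℝ := max (sgn c * y) 0

theorem depth_false_sub_depth_true (y : ℝ) : depth false y - depth true y = y := by
  rcases le_total y 0 with h | h <;> simp [depth, sgn, h]

theorem depth_nonneg (c : Bool) (y : ℝ) : 0 ≤ depth c y := le_max_right _ _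

theorem depth_eq {c : Bool} {y : ℝ} (h : 0 ≤ sgn c * y) : depth c y = sgn c * y := max_eq_left h

theorem depth_eq_zero {c : Bool} {y : ℝ} (h : sgn c * y ≤ 0) : depth c y = 0 := max_eq_right h

theorem abs_eq_sgn_mul {c : Bool} {y : ℝ} (h : 0 ≤ sgn c * y) : |y| = sgn c * y := by
  cases c <;> simp [sgn] at h ⊢ <;> exact h

theorem continuous_depth (c : Bool) : Continuous (depth c) := by
  unfold depth
  fun_prop

namespace CellData

variable {V E : Type} {Face : Bool → Type} {len : Bool → ℕ} {N : ℕ} [∀ c, NeZero (len c)]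
  [NeZero N] (M : CellData V E Face len N)

/-- The face of colour `c` at an edge. -/
def faceOf (c : Bool) (e : E) : Face c := ((M.faceEdge c).symm e).1

/-- The position of an edge in its face of colour `c`. -/
def pos (c : Bool) (e : E) : Fin (len c) := ((M.faceEdge c).symm e).2

theorem faceEdge_faceOf_pos (c : Bool) (e : E) : M.faceEdge c (M.faceOf c e, M.pos c e) = e :=
  (M.faceEdge c).apply_symm_apply e

@[simp] theorem faceOf_faceEdge (c : Bool) (F : Face c) (j : Fin (len c)) :
    M.faceOf c (M.faceEdge c (F, j)) = F := by simp [faceOf]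

@[simp] theorem pos_faceEdge (c : Bool) (F : Face c) (j : Fin (len c)) :
    M.pos c (M.faceEdge c (F, j)) = j := by simp [pos]

theorem next_eq_faceEdge (c : Bool) (e : E) :
    M.next c e = M.faceEdge c (M.faceOf c e, M.pos c e + 1) := by
  rw [M.faceEdge_succ, M.faceEdge_faceOf_pos]

@[simp] theorem faceOf_next (c : Bool) (e : E) : M.faceOf c (M.next c e) = M.faceOf c e := by
  rw [next_eq_faceEdge, faceOf_faceEdge]

@[simp] theorem pos_next (c : Bool) (e : E) : M.pos c (M.next c e) = M.pos c e + 1 := by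
  rw [next_eq_faceEdge, pos_faceEdge]

theorem tgt_eq_of_next_symm (c : Bool) (e : E) : M.tgt ((M.next c).symm e) = M.src e := by
  rw [← M.src_next c, Equiv.apply_symm_apply]

/-- The space in which the surface is realized. -/
abbrev Ambient (V E : Type) (Face : Bool → Type) : Type :=
  (V → ℝ) × (E → ℝ) × (∀ c, Face c → ℝ) × (∀ c, Face c → ℂ)

open Classical in
/-- The point with coordinates `(y, θ)` in the lozenge formed by an edge and its two sectors in
the faces at its sides; `θ` runs along the edge and `y` runs across, with the edge at `y = 0` and
the centres of the two faces at `y = -1` and `y = 1`. -/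
noncomputable def point (e : E) (y θ : ℝ) : Ambient V E Face :=
  -- The polar radius `d * (1 - d)` vanishes at depth `0`, where the point passes to the other face,
  -- and at depth `1`, where the angle is undefined. The bump `θ * (1 - θ)` vanishes at the ends,
  -- where the edge is no longer determined.
  (fun x => (1 - |y|) * ((1 - θ) * (if M.src e = x then 1 else 0)
      + θ * (if M.tgt e = x then 1 else 0)),
    fun e' => if e = e' then (1 - |y|) * (θ * (1 - θ)) else 0,
    fun c F => if M.faceOf c e = F then depth c y else 0,
    fun c F => if M.faceOf c e = F then
      polar (len c) (M.pos c e) (depth c y * (1 - depth c y)) θ else 0)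

theorem continuous_point (e : E) {α : Type*} [TopologicalSpace α] {y θ : α → ℝ}
    (hy : Continuous y) (hθ : Continuous θ) : Continuous fun a => M.point e (y a) (θ a) := by
  unfold point
  refine Continuous.prodMk ?_ (Continuous.prodMk ?_ (Continuous.prodMk ?_ ?_))
  · fun_prop
  · refine continuous_pi fun e' => ?_
    split_ifs <;> fun_prop
  · refine continuous_pi fun c => continuous_pi fun F => ?_
    have := (continuous_depth c).comp hy
    split_ifs
    · exact this
    · fun_prop
  · refine continuous_pi fun c => continuous_pi fun F => ?_
    have := (continuous_depth c).comp hy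
    split_ifs
    · exact continuous_polar (this.mul (continuous_const.sub this)) hθ
    · fun_prop

/-- `x` is the end of the edge `e` at the parameter `θ`. -/
def IsEnd (e : E) (θ : ℝ) (x : V) : Prop := (θ = 0 ∧ M.src e = x) ∨ (θ = 1 ∧ M.tgt e = x)

/-- The identifications between the points of the lozenges. -/
def Rel (e : E) (y θ : ℝ) (e' : E) (y' θ' : ℝ) : Prop :=
  y = y' ∧ ((e = e' ∧ θ = θ') ∨ (y = 0 ∧ ∃ x, M.IsEnd e θ x ∧ M.IsEnd e' θ' x) ∨
    ∃ c, 0 < sgn c * y ∧ M.faceOf c e = M.faceOf c e' ∧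
      (sgn c * y = 1 ∨ (θ = 1 ∧ θ' = 0 ∧ e' = M.next c e) ∨ (θ = 0 ∧ θ' = 1 ∧ e = M.next c e')))

/-- On this side of the edge the coordinates of the other colour vanish. Those of colour `c` agree
since the two edges occupy consecutive positions of one face. -/
theorem point_next {c : Bool} {y : ℝ} (hy : 0 ≤ sgn c * y) (e : E) :
    M.point (M.next c e) y 0 = M.point e y 1 := by
  classical
  have hd : ∀ c', c' ≠ c → depth c' y = 0 := by
    intro c' hc'
    apply depth_eq_zero
    cases c <;> cases c' <;> simp [sgn] at hy hc' ⊢ <;> exact hy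
  unfold point
  refine Prod.ext ?_ (Prod.ext ?_ (Prod.ext ?_ ?_))
  · funext x
    simp [M.src_next]
  · funext e'
    simp
  · funext c' F
    by_cases h : c' = c
    · subst h
      simp
    · simp [hd c' h]
  · funext c' F
    by_cases h : c' = c
    · subst h
      simp only [faceOf_next, pos_next, polar_succ]
    · simp [hd c' h, polar]

theorem point_center {c : Bool} {y : ℝ} (hy : sgn c * y = 1) {e e' : E}
    (he : M.faceOf c e = M.faceOf c e') (θ θ' : ℝ) : M.point e y θ = M.point e' y θ' := by
  classical
  have hd : ∀ c', c' ≠ c → depth c' y = 0 := by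
    intro c' hc'
    apply depth_eq_zero
    cases c <;> cases c' <;> simp [sgn] at hy hc' ⊢ <;> linarith
  have hd1 : depth c y = 1 := by rw [depth_eq (by rw [hy]; norm_num), hy]
  have ha : |y| = 1 := by rw [abs_eq_sgn_mul (by rw [hy]; norm_num), hy]
  unfold point
  refine Prod.ext ?_ (Prod.ext ?_ (Prod.ext ?_ ?_))
  · funext x
    simp [ha]
  · funext e'
    simp [ha]
  · funext c' F
    by_cases h : c' = c
    · subst h
      simp [he]
    · simp [hd c' h]
  · funext c' F
    by_cases h : c' = c
    · subst h
      simp [hd1, polar]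
    · simp [hd c' h, polar]

open Classical in
theorem point_of_isEnd {e : E} {θ : ℝ} {x : V} (h : M.IsEnd e θ x) :
    M.point e 0 θ = (fun x' => if x = x' then 1 else 0, 0, 0, 0) := by
  unfold point
  refine Prod.ext ?_ (Prod.ext ?_ (Prod.ext ?_ ?_))
  · funext x'
    rcases h with ⟨rfl, h⟩ | ⟨rfl, h⟩ <;> simp [h]
  · funext e'
    rcases h with ⟨rfl, h⟩ | ⟨rfl, h⟩ <;> simp
  · funext c' F
    simp [depth]
  · funext c' F
    simp [depth, polar]

theorem point_eq_of_rel {e e' : E} {y y' θ θ' : ℝ} (h : M.Rel e y θ e' y' θ') :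
    M.point e y θ = M.point e' y' θ' := by
  obtain ⟨rfl, ⟨rfl, rfl⟩ | ⟨rfl, x, hx, hx'⟩ | ⟨c, hc, hf, h | ⟨rfl, rfl, rfl⟩ | ⟨rfl, rfl, rfl⟩⟩⟩ := h
  · rfl
  · rw [M.point_of_isEnd hx, M.point_of_isEnd hx']
  · exact M.point_center h hf _ _
  · rw [M.point_next hc.le]
  · rw [M.point_next hc.le]

theorem depth_eq_of_point_eq {e e' : E} {y y' θ θ' : ℝ}
    (h : M.point e y θ = M.point e' y' θ') (c : Bool) (hc : 0 < depth c y) :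
    M.faceOf c e = M.faceOf c e' ∧ depth c y = depth c y' := by
  have h3 := congrFun (congrFun (congrArg (fun q => q.2.2.1) h) c) (M.faceOf c e)
  simp only [point, if_true] at h3
  split_ifs at h3 with h4
  · exact ⟨h4.symm, h3⟩
  · rw [h3] at hc
    exact absurd hc (lt_irrefl _)

/-- The depths recover `y`. On the skeleton, the bump recovers the edge of an interior point and the
vertex coordinates then give `θ` or the common end. Off the skeleton, the depth coordinate
identifies the face, and the polar coordinate gives the position in it except at the centre. -/
theorem rel_of_point_eq {e e' : E} {y y' θ θ' : ℝ} (hθ : θ ∈ Icc (0 : ℝ) 1)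
    (hθ' : θ' ∈ Icc (0 : ℝ) 1) (h : M.point e y θ = M.point e' y' θ') :
    M.Rel e y θ e' y' θ' := by
  classical
  have hdep : ∀ c, depth c y = depth c y' := by
    intro c
    rcases (depth_nonneg c y).eq_or_lt with h0 | h0
    · rcases (depth_nonneg c y').eq_or_lt with h1 | h1
      · rw [← h0, ← h1]
      · exact (M.depth_eq_of_point_eq h.symm c h1).2.symm
    · exact (M.depth_eq_of_point_eq h c h0).2
  have hyy : y = y' := by
    rw [← depth_false_sub_depth_true y, ← depth_false_sub_depth_true y', hdep, hdep]
  subst hyy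
  refine ⟨rfl, ?_⟩
  by_cases hy : y = 0
  · subst hy
    have h1 : ∀ x, ((1 - θ) * (if M.src e = x then 1 else 0) + θ * (if M.tgt e = x then 1 else 0))
        = ((1 - θ') * (if M.src e' = x then 1 else 0) + θ' * (if M.tgt e' = x then 1 else 0)) := by
      intro x
      have := congrFun (congrArg (fun q => q.1) h) x
      simpa only [point, abs_zero, sub_zero, one_mul] using this
    have h2 : ∀ e₁, (if e = e₁ then θ * (1 - θ) else 0) = (if e' = e₁ then θ' * (1 - θ') else 0) := by
      intro e₁
      have := congrFun (congrArg (fun q => q.2.1) h) e₁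
      simpa only [point, abs_zero, sub_zero, one_mul] using this
    by_cases hee : e = e'
    · subst hee
      left
      have := h1 (M.tgt e)
      simp only [M.src_ne_tgt, if_false, if_true] at this
      exact ⟨rfl, by linarith⟩
    · right; left
      have ha := h2 e
      have hb := h2 e'
      simp only [if_true, hee, if_false, Ne.symm hee] at ha hb
      refine ⟨rfl, ?_⟩
      have hends : ∀ t : ℝ, t * (1 - t) = 0 → t = 0 ∨ t = 1 := by
        intro t ht
        rcases mul_eq_zero.1 ht with h | h
        · exact Or.inl h
        · right; linarith
      rcases hends θ ha with rfl | rfl <;> rcases hends θ' hb.symm with rfl | rfl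
      · refine ⟨M.src e, Or.inl ⟨rfl, rfl⟩, Or.inl ⟨rfl, ?_⟩⟩
        have := h1 (M.src e)
        by_contra hne
        simp [hne] at this
      · refine ⟨M.src e, Or.inl ⟨rfl, rfl⟩, Or.inr ⟨rfl, ?_⟩⟩
        have := h1 (M.src e)
        by_contra hne
        simp [hne] at this
      · refine ⟨M.tgt e, Or.inr ⟨rfl, rfl⟩, Or.inl ⟨rfl, ?_⟩⟩
        have := h1 (M.tgt e)
        by_contra hne
        simp [hne] at this
      · refine ⟨M.tgt e, Or.inr ⟨rfl, rfl⟩, Or.inr ⟨rfl, ?_⟩⟩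
        have := h1 (M.tgt e)
        by_contra hne
        simp [hne] at this
  · obtain ⟨c, hc⟩ := exists_sgn_mul_pos hy
    have hd := depth_eq hc.le
    obtain ⟨hf, -⟩ := M.depth_eq_of_point_eq h c (by rw [hd]; exact hc)
    by_cases h1 : sgn c * y = 1
    · exact Or.inr (Or.inr ⟨c, hc, hf, Or.inl h1⟩)
    have h4 := congrFun (congrFun (congrArg (fun q => q.2.2.2) h) c) (M.faceOf c e)
    simp only [point, if_true, hf] at h4
    rw [hd] at h4
    have hsp := samePosition_of_polar_eq hθ hθ'
      (mul_ne_zero hc.ne' (sub_ne_zero.2 (Ne.symm h1))) h4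
    rcases hsp with ⟨hj, hφ⟩ | ⟨h0, h1, hj⟩ | ⟨h0, h1, hj⟩
    · left
      refine ⟨?_, hφ⟩
      rw [← M.faceEdge_faceOf_pos c e, ← M.faceEdge_faceOf_pos c e', hf, hj]
    · refine Or.inr (Or.inr ⟨c, hc, hf, Or.inr (Or.inl ⟨h0, h1, ?_⟩)⟩)
      rw [next_eq_faceEdge, ← M.faceEdge_faceOf_pos c e', hf, hj]
    · refine Or.inr (Or.inr ⟨c, hc, hf, Or.inr (Or.inr ⟨h0, h1, ?_⟩)⟩)
      rw [next_eq_faceEdge, ← M.faceEdge_faceOf_pos c e, hf, hj]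

/-- The surface glued from the lozenges of the edges. -/
def Surface : Type :=
  {q : Ambient V E Face // ∃ e, ∃ y ∈ Icc (-1 : ℝ) 1, ∃ θ ∈ Icc (0 : ℝ) 1, M.point e y θ = q}

noncomputable instance : TopologicalSpace M.Surface :=
  inferInstanceAs (TopologicalSpace {q : Ambient V E Face //
    ∃ e, ∃ y ∈ Icc (-1 : ℝ) 1, ∃ θ ∈ Icc (0 : ℝ) 1, M.point e y θ = q})

instance : T2Space M.Surface :=
  inferInstanceAs (T2Space {q : Ambient V E Face //
    ∃ e, ∃ y ∈ Icc (-1 : ℝ) 1, ∃ θ ∈ Icc (0 : ℝ) 1, M.point e y θ = q})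

/-- The point of the surface with given coordinates in the lozenge of an edge; the coordinates are
clamped to `[-1, 1] × [0, 1]`. -/
noncomputable def pt (e : E) (y θ : ℝ) : M.Surface :=
  ⟨M.point e (projIcc (-1) 1 (by norm_num) y : ℝ) (projIcc 0 1 zero_le_one θ : ℝ),
    e, _, Subtype.coe_prop _, _, Subtype.coe_prop _, rfl⟩

theorem continuous_pt (e : E) {α : Type*} [TopologicalSpace α] {y θ : α → ℝ}
    (hy : Continuous y) (hθ : Continuous θ) : Continuous fun a => M.pt e (y a) (θ a) :=
  Continuous.subtype_mk (M.continuous_point e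
    (continuous_subtype_val.comp (continuous_projIcc.comp hy))
    (continuous_subtype_val.comp (continuous_projIcc.comp hθ))) _

theorem val_pt {e : E} {y θ : ℝ} (hy : y ∈ Icc (-1 : ℝ) 1) (hθ : θ ∈ Icc (0 : ℝ) 1) :
    (M.pt e y θ).1 = M.point e y θ := by
  simp only [pt, projIcc_of_mem _ hy, projIcc_of_mem _ hθ]

theorem pt_eq_pt_iff {e e' : E} {y y' θ θ' : ℝ} (hy : y ∈ Icc (-1 : ℝ) 1)
    (hy' : y' ∈ Icc (-1 : ℝ) 1) (hθ : θ ∈ Icc (0 : ℝ) 1) (hθ' : θ' ∈ Icc (0 : ℝ) 1) :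
    M.pt e y θ = M.pt e' y' θ' ↔ M.Rel e y θ e' y' θ' := by
  have h : M.pt e y θ = M.pt e' y' θ' ↔ M.point e y θ = M.point e' y' θ' := by
    rw [← M.val_pt hy hθ, ← M.val_pt hy' hθ']
    exact Subtype.ext_iff
  rw [h]
  exact ⟨M.rel_of_point_eq hθ hθ', M.point_eq_of_rel⟩

theorem exists_pt_eq (q : M.Surface) :
    ∃ e, ∃ y ∈ Icc (-1 : ℝ) 1, ∃ θ ∈ Icc (0 : ℝ) 1, M.pt e y θ = q := by
  obtain ⟨q, e, y, hy, θ, hθ, rfl⟩ := q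
  exact ⟨e, y, hy, θ, hθ, Subtype.ext (M.val_pt hy hθ)⟩

/-- The lozenge of an edge. -/
noncomputable def lozenge (e : E) (a : Icc (-1 : ℝ) 1 × Icc (0 : ℝ) 1) : M.Surface :=
  M.pt e a.1 a.2

theorem continuous_lozenge (e : E) : Continuous (M.lozenge e) :=
  M.continuous_pt e (by fun_prop) (by fun_prop)

theorem iUnion_range_lozenge : ⋃ e, range (M.lozenge e) = univ := by
  refine eq_univ_of_forall fun q => ?_
  obtain ⟨e, y, hy, θ, hθ, rfl⟩ := M.exists_pt_eq q
  exact mem_iUnion.2 ⟨e, ⟨⟨y, hy⟩, ⟨θ, hθ⟩⟩, rfl⟩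

instance [Finite E] : CompactSpace M.Surface := by
  refine ⟨?_⟩
  rw [← M.iUnion_range_lozenge]
  exact isCompact_iUnion fun e => isCompact_range (M.continuous_lozenge e)

/-- The surface carries the quotient topology of the lozenges: the complement of `U` is a finite
union of continuous images of compact sets. -/
theorem isOpen_of_preimage_lozenge [Finite E] {U : Set M.Surface}
    (h : ∀ e, IsOpen (M.lozenge e ⁻¹' U)) : IsOpen U := by
  rw [← isClosed_compl_iff]
  have : Uᶜ = ⋃ e, M.lozenge e '' (M.lozenge e ⁻¹' U)ᶜ := by
    ext q
    constructor
    · intro hq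
      obtain ⟨e, a, rfl⟩ := mem_iUnion.1 (M.iUnion_range_lozenge.symm ▸ mem_univ q)
      exact mem_iUnion.2 ⟨e, a, hq, rfl⟩
    · intro hq
      obtain ⟨e, a, ha, rfl⟩ := mem_iUnion.1 hq
      exact ha
  rw [this]
  exact isClosed_iUnion_of_finite fun e =>
    ((h e).isClosed_compl.isCompact.image (M.continuous_lozenge e)).isClosed

/-- The coordinate with values in the sphere: the unit circle is the image of every edge, and the
centres of faces are mapped to `0` and `∞`. -/
noncomputable def developing (y θ : ℝ) : ℂ :=
  ((1 + y) / (1 - y) : ℝ) * Complex.exp (2 * Real.pi * Complex.I * θ)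

theorem developing_one (y : ℝ) : developing y 1 = developing y 0 := by
  simp [developing]

/-- Changing `θ` from `1` to `0` does not affect the exponential, which settles both common ends and
consecutive sectors. At a centre the modulus is `0`: genuinely so for colour `true`, and for colour
`false` because division by zero puts `0` in place of `∞`. -/
theorem developing_eq_of_rel {e e' : E} {y y' θ θ' : ℝ} (h : M.Rel e y θ e' y' θ') :
    developing y θ = developing y' θ' := by
  obtain ⟨rfl, ⟨rfl, rfl⟩ | ⟨rfl, x, ⟨rfl, -⟩ | ⟨rfl, -⟩, ⟨rfl, -⟩ | ⟨rfl, -⟩⟩ |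
    ⟨c, hc, hf, h | ⟨rfl, rfl, rfl⟩ | ⟨rfl, rfl, rfl⟩⟩⟩ := h <;>
    try first | rfl | exact developing_one _ | exact (developing_one _).symm
  have : y = sgn c := by
    have := congrArg (sgn c * ·) h
    simpa [← mul_assoc, sgn_mul_self] using this
  subst this
  cases c <;> simp [developing, sgn]

end CellData

/-! ### Disc coordinates on the faces -/

theorem polar_eq_polar_iff {n : ℕ} [NeZero n] {j j' : Fin n} {φ φ' t t' : ℝ}
    (ht : 0 ≤ t) (ht' : 0 ≤ t') (hφ : φ ∈ Icc (0 : ℝ) 1) (hφ' : φ' ∈ Icc (0 : ℝ) 1) :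
    polar n j t φ = polar n j' t' φ' ↔ t = t' ∧ (t = 0 ∨ SamePosition j φ j' φ') := by
  constructor
  · intro h
    have htt : t = t' := by
      rw [← norm_polar (n := n) j ht φ, ← norm_polar (n := n) j' ht' φ', h]
    subst htt
    refine ⟨rfl, ?_⟩
    by_cases h0 : t = 0
    · exact Or.inl h0
    · exact Or.inr (samePosition_of_polar_eq hφ hφ' h0 h)
  · rintro ⟨rfl, rfl | h⟩
    · simp [polar]
    · exact h.polar_eq t

/-- The depth in an `n`-gonal face of the points at distance `t` from the centre. -/
noncomputable def radial (n : ℕ) (t : ℝ) : ℝ := (1 - t ^ n) / (1 + t ^ n)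

section Radial

variable {n : ℕ} {t : ℝ}

theorem radial_mem (ht : t ∈ Icc (0 : ℝ) 1) : radial n t ∈ Icc (0 : ℝ) 1 := by
  have h0 : 0 ≤ t ^ n := pow_nonneg ht.1 n
  have h1 : t ^ n ≤ 1 := pow_le_one₀ ht.1 ht.2
  exact ⟨div_nonneg (by linarith) (by linarith), (div_le_one (by linarith)).2 (by linarith)⟩

/-- This is what the profile `radial` is made for: with `d` the depth, `(1 - d) / (1 + d)` is the
modulus of the developing map on colour `true`, and its inverse on colour `false`. -/
theorem pow_eq_of_radial (ht : 0 ≤ t) : t ^ n = (1 - radial n t) / (1 + radial n t) := by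
  have h0 : 0 ≤ t ^ n := pow_nonneg ht n
  have h1 : 1 + t ^ n ≠ 0 := by positivity
  rw [radial]
  field_simp
  ring

theorem radial_injOn (hn : n ≠ 0) {t' : ℝ} (ht : 0 ≤ t) (ht' : 0 ≤ t')
    (h : radial n t = radial n t') : t = t' := by
  have h1 : t ^ n = t' ^ n := by rw [pow_eq_of_radial ht, pow_eq_of_radial ht', h]
  exact (pow_left_inj₀ ht ht' hn).1 h1

@[simp] theorem radial_zero (hn : n ≠ 0) : radial n 0 = 1 := by simp [radial, hn]

@[simp] theorem radial_one : radial n 1 = 0 := by simp [radial]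

theorem exists_radial_eq (hn : n ≠ 0) {d : ℝ} (hd : d ∈ Icc (0 : ℝ) 1) :
    ∃ t ∈ Icc (0 : ℝ) 1, radial n t = d := by
  have h0 : 0 ≤ (1 - d) / (1 + d) := div_nonneg (by linarith [hd.2]) (by linarith [hd.1])
  have h1 : (1 - d) / (1 + d) ≤ 1 := (div_le_one (by linarith [hd.1])).2 (by linarith [hd.1])
  refine ⟨((1 - d) / (1 + d)) ^ (n : ℝ)⁻¹, ⟨Real.rpow_nonneg h0 _,
    Real.rpow_le_one h0 h1 (by positivity)⟩, ?_⟩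
  rw [radial, Real.rpow_inv_natCast_pow h0 hn]
  have : 1 + d ≠ 0 := by linarith [hd.1]
  field_simp
  ring

theorem radial_pos (hn : n ≠ 0) (ht : 0 ≤ t) (ht1 : t < 1) : 0 < radial n t := by
  have h0 : 0 ≤ t ^ n := pow_nonneg ht n
  have h1 : t ^ n < 1 := pow_lt_one₀ ht ht1 hn
  exact div_pos (by linarith) (by linarith)

theorem continuous_radial_comp {α : Type*} [TopologicalSpace α] {t : α → unitInterval}
    (ht : Continuous t) : Continuous fun a => radial n (t a) := by
  unfold radial
  refine Continuous.div (by fun_prop) (by fun_prop) fun a => ?_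
  have := pow_nonneg (t a).2.1 n
  positivity

end Radial

/-- Faces of one of the colours are seen from the other side. -/
noncomputable def orient (c : Bool) (z : ℂ) : ℂ := if c then z else (starRingEnd ℂ) z

theorem orient_injective (c : Bool) : Function.Injective (orient c) := by
  intro z w h
  cases c
  · exact (starRingEnd ℂ).injective (by simpa [orient] using h)
  · simpa [orient] using h

theorem continuous_orient (c : Bool) : Continuous (orient c) := by
  cases c
  · exact Complex.continuous_conj
  · exact continuous_id

theorem norm_orient (c : Bool) (z : ℂ) : ‖orient c z‖ = ‖z‖ := by
  cases c <;> simp [orient]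

theorem orient_orient (c : Bool) (z : ℂ) : orient c (orient c z) = z := by
  cases c <;> simp [orient]

namespace CellData

variable {V E : Type} {Face : Bool → Type} {len : Bool → ℕ} {N : ℕ} [∀ c, NeZero (len c)]
  [NeZero N] (M : CellData V E Face len N)

theorem pt_next {c : Bool} {y : ℝ} (hy1 : y ∈ Icc (-1 : ℝ) 1) (hy : 0 ≤ sgn c * y) (e : E) :
    M.pt (M.next c e) y 0 = M.pt e y 1 := by
  refine Subtype.ext ?_
  rw [M.val_pt hy1 (by simp), M.val_pt hy1 (by simp), M.point_next hy]

theorem sgn_mul_mem {c : Bool} {d : ℝ} (hd : d ∈ Icc (0 : ℝ) 1) : sgn c * d ∈ Icc (-1 : ℝ) 1 := by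
  obtain ⟨h0, h1⟩ := hd
  cases c <;> simp only [sgn] <;> constructor <;> norm_num <;> linarith

theorem sgn_mul_le_one {c : Bool} {y : ℝ} (hy : y ∈ Icc (-1 : ℝ) 1) : sgn c * y ≤ 1 := by
  obtain ⟨h0, h1⟩ := hy
  cases c <;> simp [sgn] <;> linarith

/-! #### Faces -/

/-- The interior of a face. -/
def openFace (c : Bool) (F : Face c) : Set M.Surface := {q | 0 < q.1.2.2.1 c F}

theorem isOpen_openFace (c : Bool) (F : Face c) : IsOpen (M.openFace c F) := by
  have h : Continuous fun q : M.Surface => q.1.2.2.1 c F := by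
    have : Continuous fun q : M.Surface => q.1 := continuous_subtype_val
    fun_prop
  exact isOpen_lt continuous_const h

theorem pt_mem_openFace {c : Bool} {F : Face c} {e : E} {y θ : ℝ} (hy : y ∈ Icc (-1 : ℝ) 1)
    (hθ : θ ∈ Icc (0 : ℝ) 1) : M.pt e y θ ∈ M.openFace c F ↔ M.faceOf c e = F ∧ 0 < sgn c * y := by
  rw [openFace, mem_ofPred_eq, M.val_pt hy hθ]
  simp only [point]
  split_ifs with h
  · simp [h, depth]
  · simp [h]

theorem eq_of_mem_openFace {c c' : Bool} {F : Face c} {F' : Face c'} {q : M.Surface}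
    (h : q ∈ M.openFace c F) (h' : q ∈ M.openFace c' F') :
    (⟨c, F⟩ : Σ c, Face c) = ⟨c', F'⟩ := by
  obtain ⟨e, y, hy, θ, hθ, rfl⟩ := M.exists_pt_eq q
  rw [M.pt_mem_openFace hy hθ] at h h'
  obtain rfl := eq_of_sgn_mul_pos h.2 h'.2
  obtain rfl := h'.1
  rw [h.1]

/-- A face as a disc glued from its sectors. -/
noncomputable def faceMap (c : Bool) (F : Face c)
    (a : Fin (len c) × unitInterval × unitInterval) : M.Surface :=
  M.pt (M.faceEdge c (F, a.1)) (sgn c * radial (len c) a.2.1) a.2.2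

/-- The coordinate of a face. -/
noncomputable def faceCoord (c : Bool) (n : ℕ) (a : Fin n × unitInterval × unitInterval) : ℂ :=
  orient c (polar n a.1 a.2.1 a.2.2)

theorem continuous_faceMap (c : Bool) (F : Face c) : Continuous (M.faceMap c F) := by
  rw [continuous_prod_of_discrete_left]
  intro j
  have h1 : Continuous fun x : unitInterval × unitInterval => sgn c * radial (len c) x.1 :=
    continuous_const.mul (continuous_radial_comp continuous_fst)
  have h2 : Continuous fun x : unitInterval × unitInterval => (x.2 : ℝ) :=
    continuous_subtype_val.comp continuous_snd
  exact M.continuous_pt (M.faceEdge c (F, j)) h1 h2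

theorem continuous_faceCoord (c : Bool) (n : ℕ) : Continuous (faceCoord c n) := by
  rw [continuous_prod_of_discrete_left]
  intro j
  have h1 : Continuous fun x : unitInterval × unitInterval => (x.1 : ℝ) :=
    continuous_subtype_val.comp continuous_fst
  have h2 : Continuous fun x : unitInterval × unitInterval => (x.2 : ℝ) :=
    continuous_subtype_val.comp continuous_snd
  have h3 : Continuous fun x : unitInterval × unitInterval => polar n j x.1 x.2 :=
    continuous_polar h1 h2
  exact (continuous_orient c).comp h3

theorem norm_faceCoord (c : Bool) (n : ℕ) (a : Fin n × unitInterval × unitInterval) :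
    ‖faceCoord c n a‖ = a.2.1 := by
  have h : (0 : ℝ) ≤ a.2.1 := a.2.1.2.1
  rw [faceCoord, norm_orient, norm_polar _ h]

/-- No vertex occurs twice on the boundary of a face; for Heffter arrays this is the simplicity of
the orderings. -/
theorem samePosition_of_isEnd {c : Bool} {F : Face c} {j j' : Fin (len c)} {φ φ' : ℝ} {x : V}
    (h : M.IsEnd (M.faceEdge c (F, j)) φ x) (h' : M.IsEnd (M.faceEdge c (F, j')) φ' x) :
    SamePosition j φ j' φ' := by
  have hinj := M.src_faceEdge_injective c F
  unfold IsEnd at h h'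
  rw [← M.src_next c, ← M.faceEdge_succ] at h h'
  rcases h with ⟨h1, h⟩ | ⟨h1, h⟩ <;> rcases h' with ⟨h1', h'⟩ | ⟨h1', h'⟩ <;>
    have := hinj (h.trans h'.symm)
  · exact Or.inl ⟨this, h1.trans h1'.symm⟩
  · exact Or.inr (Or.inr ⟨h1, h1', this⟩)
  · exact Or.inr (Or.inl ⟨h1, h1', this.symm⟩)
  · exact Or.inl ⟨add_right_cancel this, h1.trans h1'.symm⟩

/-- The identifications inside one closed face are those of a closed disc cut into sectors: common
radii, the centre, and common vertices on the boundary circle. The boundary is included so that the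
domain is compact, as `exists_disc_chart` requires. -/
theorem faceMap_eq_iff (c : Bool) (F : Face c) (a b : Fin (len c) × unitInterval × unitInterval) :
    M.faceMap c F a = M.faceMap c F b ↔ faceCoord c (len c) a = faceCoord c (len c) b := by
  obtain ⟨j, t, φ⟩ := a
  obtain ⟨j', t', φ'⟩ := b
  have hn : len c ≠ 0 := NeZero.ne _
  have hr : ∀ t : unitInterval, sgn c * radial (len c) t ∈ Icc (-1 : ℝ) 1 := fun t =>
    sgn_mul_mem (radial_mem t.2)
  have hs : ∀ d : ℝ, sgn c * (sgn c * d) = d := fun d => by rw [← mul_assoc, sgn_mul_self, one_mul]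
  rw [faceCoord, faceCoord, (orient_injective c).eq_iff,
    polar_eq_polar_iff t.2.1 t'.2.1 φ.2 φ'.2]
  constructor
  · intro h
    obtain ⟨hy, h⟩ := (M.pt_eq_pt_iff (hr t) (hr t') φ.2 φ'.2).1 h
    have htt : (t : ℝ) = t' := radial_injOn hn t.2.1 t'.2.1 (mul_left_cancel₀ (sgn_ne_zero c) hy)
    refine ⟨htt, ?_⟩
    rcases h with ⟨he, hφ⟩ | ⟨h0, x, hx, hx'⟩ | ⟨c', hc', hf, h⟩
    · right; left
      have := (M.faceEdge c).injective he
      exact ⟨congrArg Prod.snd this, hφ⟩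
    · exact Or.inr (M.samePosition_of_isEnd hx hx')
    · have hcc : c' = c := by
        refine eq_of_sgn_mul_pos hc' (lt_of_le_of_ne ?_ ?_)
        · rw [hs]; exact (radial_mem t.2).1
        · rw [hs]
          intro h0
          rw [← h0] at hc'
          simp at hc'
      subst hcc
      rcases h with h | ⟨h1, h2, h3⟩ | ⟨h1, h2, h3⟩
      · left
        rw [hs] at h
        exact radial_injOn hn t.2.1 le_rfl (by rw [radial_zero hn]; exact h)
      · rw [← M.faceEdge_succ] at h3
        have := congrArg Prod.snd ((M.faceEdge c').injective h3)
        exact Or.inr (Or.inr (Or.inl ⟨h1, h2, this⟩))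
      · rw [← M.faceEdge_succ] at h3
        have := congrArg Prod.snd ((M.faceEdge c').injective h3)
        exact Or.inr (Or.inr (Or.inr ⟨h1, h2, this⟩))
  · rintro ⟨htt, h⟩
    obtain rfl := Subtype.ext htt
    rcases h with h | ⟨rfl, h⟩ | ⟨h1, h2, rfl⟩ | ⟨h1, h2, rfl⟩
    · rw [faceMap, faceMap, M.pt_eq_pt_iff (hr t) (hr t) φ.2 φ'.2]
      have h1 : sgn c * (sgn c * radial (len c) t) = 1 := by rw [hs, h, radial_zero hn]
      exact ⟨rfl, Or.inr (Or.inr ⟨c, by rw [h1]; norm_num, by simp, Or.inl h1⟩)⟩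
    · simp only [faceMap, h]
    · simp only [faceMap, h1, h2, M.faceEdge_succ]
      rw [M.pt_next (hr t) (by rw [hs]; exact (radial_mem t.2).1)]
    · simp only [faceMap, h1, h2, M.faceEdge_succ]
      rw [M.pt_next (hr t) (by rw [hs]; exact (radial_mem t.2).1)]

theorem exists_faceMap_eq {c : Bool} {e : E} {y θ : ℝ} (hy : y ∈ Icc (-1 : ℝ) 1)
    (hy0 : 0 ≤ sgn c * y) (hθ : θ ∈ Icc (0 : ℝ) 1) :
    ∃ a, M.faceMap c (M.faceOf c e) a = M.pt e y θ ∧ radial (len c) a.2.1 = sgn c * y := by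
  obtain ⟨t, ht, hty⟩ := exists_radial_eq (n := len c) (NeZero.ne _) ⟨hy0, sgn_mul_le_one hy⟩
  refine ⟨(M.pos c e, ⟨t, ht⟩, ⟨θ, hθ⟩), ?_, hty⟩
  simp only [faceMap, M.faceEdge_faceOf_pos, hty]
  rw [← mul_assoc, sgn_mul_self, one_mul]

theorem faceMap_mem_openFace (c : Bool) (F : Face c)
    (a : Fin (len c) × unitInterval × unitInterval) :
    M.faceMap c F a ∈ M.openFace c F ↔ (a.2.1 : ℝ) < 1 := by
  rw [faceMap, M.pt_mem_openFace (sgn_mul_mem (radial_mem a.2.1.2)) a.2.2.2]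
  simp only [faceOf_faceEdge, true_and]
  rw [← mul_assoc, sgn_mul_self, one_mul]
  constructor
  · intro h
    refine lt_of_le_of_ne a.2.1.2.2 fun h1 => ?_
    rw [h1, radial_one] at h
    exact lt_irrefl _ h
  · intro h
    exact radial_pos (NeZero.ne _) a.2.1.2.1 h

theorem faceMap_image_ball (c : Bool) (F : Face c) :
    M.faceMap c F '' (faceCoord c (len c) ⁻¹' ball 0 1) = M.openFace c F := by
  ext q
  constructor
  · rintro ⟨a, ha, rfl⟩
    rw [M.faceMap_mem_openFace]
    simpa [norm_faceCoord] using ha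
  · intro hq
    obtain ⟨e, y, hy, θ, hθ, rfl⟩ := M.exists_pt_eq q
    obtain ⟨rfl, h0⟩ := (M.pt_mem_openFace hy hθ).1 hq
    obtain ⟨a, ha, -⟩ := M.exists_faceMap_eq (e := e) hy h0.le hθ
    refine ⟨a, ?_, ha⟩
    rw [← ha, M.faceMap_mem_openFace] at hq
    simpa [norm_faceCoord] using hq

theorem ball_subset_range_faceCoord (c : Bool) (n : ℕ) [NeZero n] :
    ball 0 1 ⊆ range (faceCoord c n) := by
  intro w hw
  obtain ⟨j, φ, hφ, h⟩ := exists_polar_eq (n := n) (orient c w)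
  rw [norm_orient] at h
  have hw1 : ‖w‖ < 1 := by simpa using hw
  refine ⟨(j, ⟨‖w‖, norm_nonneg _, hw1.le⟩, ⟨φ, hφ⟩), ?_⟩
  simp only [faceCoord, h, orient_orient]

theorem exists_faceChart (c : Bool) (F : Face c) : ∃ ch : OpenPartialHomeomorph M.Surface ℂ,
    ch.source = M.openFace c F ∧ ch.target = ball 0 1 ∧
      ∀ a, ch (M.faceMap c F a) = faceCoord c (len c) a := by
  have h := exists_disc_chart (M.continuous_faceMap c F) (continuous_faceCoord c (len c))
    (M.faceMap_eq_iff c F) (ball_subset_range_faceCoord c (len c))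
    (by rw [M.faceMap_image_ball]; exact M.isOpen_openFace c F)
  rwa [M.faceMap_image_ball] at h

/-- For colour `false` the conjugation in `orient` reverses the angle and the inversion restores it,
so that both colours give holomorphic expressions. -/
theorem developing_faceMap {c : Bool} (a : Fin (len c) × unitInterval × unitInterval) :
    developing (sgn c * radial (len c) a.2.1) a.2.2 =
      if c then faceCoord c (len c) a ^ len c else (faceCoord c (len c) a ^ len c)⁻¹ := by
  have h0 : 0 ≤ (a.2.1 : ℝ) ^ len c := pow_nonneg a.2.1.2.1 _
  have h1 : (1 : ℝ) + (a.2.1 : ℝ) ^ len c ≠ 0 := by positivity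
  have hp := polar_pow (NeZero.ne (len c)) a.1 (a.2.1 : ℝ) (a.2.2 : ℝ)
  have hr := pow_eq_of_radial (n := len c) a.2.1.2.1
  unfold developing faceCoord
  cases c
  · simp only [orient, Bool.false_eq_true, if_false, sgn, one_mul]
    rw [← map_pow, hp, map_mul, mul_inv, ← Complex.exp_conj, ← Complex.exp_neg]
    congr 1
    · rw [← Complex.ofReal_pow, hr, Complex.conj_ofReal, ← Complex.ofReal_inv, inv_div]
    · congr 1
      simp [Complex.conj_ofReal, Complex.conj_ofNat]
  · simp only [orient, if_true, sgn]
    rw [hp, ← Complex.ofReal_pow, hr]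
    congr 2
    ring

end CellData

/-! ### Logarithmic coordinates at a vertex -/

theorem continuous_real_tanh : Continuous Real.tanh := by
  have : Real.tanh = fun x => Real.sinh x / Real.cosh x := funext Real.tanh_eq_sinh_div_cosh
  rw [this]
  exact Real.continuous_sinh.div Real.continuous_cosh fun x => (Real.cosh_pos x).ne'

theorem tanh_pos_iff {u : ℝ} : 0 < Real.tanh u ↔ 0 < u := by
  rw [Real.tanh_eq_sinh_div_cosh, div_pos_iff_of_pos_right (Real.cosh_pos u), Real.sinh_pos_iff]

theorem tanh_neg_iff {u : ℝ} : Real.tanh u < 0 ↔ u < 0 := by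
  rw [← Left.neg_pos_iff, ← Real.tanh_neg, tanh_pos_iff, Left.neg_pos_iff]

theorem tanh_eq_zero_iff {u : ℝ} : Real.tanh u = 0 ↔ u = 0 :=
  ⟨fun h => Real.tanh_injective (by rw [h, Real.tanh_zero]), fun h => by rw [h, Real.tanh_zero]⟩

theorem tanh_mem (u : ℝ) : Real.tanh u ∈ Icc (-1 : ℝ) 1 :=
  ⟨(Real.neg_one_lt_tanh u).le, (Real.tanh_lt_one u).le⟩

/-- With `y = tanh u` the developing map becomes `exp (2 * (u + iπθ))`, so `u + iπθ` is a local
coordinate at a vertex up to branching. -/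
theorem one_add_tanh_div_one_sub_tanh (u : ℝ) :
    (1 + Real.tanh u) / (1 - Real.tanh u) = Real.exp (2 * u) := by
  have h : 0 < Real.exp u := Real.exp_pos u
  have h2 : Real.exp (2 * u) = Real.exp u * Real.exp u := by rw [two_mul, Real.exp_add]
  rw [Real.tanh_eq, h2, Real.exp_neg]
  field_simp
  ring

theorem continuousOn_artanh : ContinuousOn Real.artanh (Ioo (-1) 1) := by
  have h : ContinuousOn (fun x : ℝ => 1 / 2 * Real.log ((1 + x) / (1 - x))) (Ioo (-1) 1) := by
    refine continuousOn_const.mul (ContinuousOn.log (ContinuousOn.div (by fun_prop) (by fun_prop) ?_) ?_)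
    · intro x hx
      linarith [hx.2]
    · intro x hx
      exact (div_pos (by linarith [hx.1]) (by linarith [hx.2])).ne'
  exact h.congr fun x hx => Real.artanh_eq_half_log ⟨hx.1.le, hx.2.le⟩

/-- Logarithmic coordinates around a vertex: real part. -/
noncomputable def cornerRe (N : ℕ) (t φ : ℝ) : ℝ := 2 * t ^ N * Real.cos (2 * Real.pi * φ)

/-- Logarithmic coordinates around a vertex: imaginary part, in units of `π`. -/
noncomputable def cornerIm (N : ℕ) (t φ : ℝ) : ℝ := 2 * t ^ N * Real.sin (2 * Real.pi * φ) / Real.pi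

section Corner

variable {N : ℕ} {t φ t' φ' : ℝ}

theorem corner_eq (N : ℕ) (t φ : ℝ) :
    (cornerRe N t φ + Real.pi * cornerIm N t φ * Complex.I : ℂ)
      = 2 * (t ^ N * Complex.exp (2 * Real.pi * Complex.I * φ)) := by
  have h : (2 * Real.pi * Complex.I * φ : ℂ) = ((2 * Real.pi * φ : ℝ) : ℂ) * Complex.I := by
    push_cast; ring
  have hpi : (Real.pi : ℂ) ≠ 0 := by exact_mod_cast Real.pi_ne_zero
  rw [h, Complex.exp_mul_I, cornerRe, cornerIm]
  push_cast
  field_simp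

theorem cornerIm_nonneg (ht : 0 ≤ t) (h0 : 0 ≤ φ) (h1 : φ ≤ 1 / 2) : 0 ≤ cornerIm N t φ := by
  have : 0 ≤ Real.sin (2 * Real.pi * φ) :=
    Real.sin_nonneg_of_nonneg_of_le_pi (by positivity) (by nlinarith [Real.pi_pos])
  unfold cornerIm
  positivity

theorem cornerIm_nonpos (ht : 0 ≤ t) (h0 : 1 / 2 ≤ φ) (h1 : φ ≤ 1) : cornerIm N t φ ≤ 0 := by
  have h : 0 ≤ Real.sin (2 * Real.pi * φ - Real.pi) :=
    Real.sin_nonneg_of_nonneg_of_le_pi (by nlinarith [Real.pi_pos]) (by nlinarith [Real.pi_pos])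
  rw [Real.sin_sub_pi] at h
  unfold cornerIm
  refine div_nonpos_of_nonpos_of_nonneg (mul_nonpos_of_nonneg_of_nonpos (by positivity) ?_)
    Real.pi_pos.le
  linarith

/-- Since `2 < π`, a disc of radius `2` in the coordinate `u + iπθ` does not run along an edge as
far as its other end. -/
theorem abs_cornerIm_lt_one (ht : t ∈ Icc (0 : ℝ) 1) : |cornerIm N t φ| < 1 := by
  have h0 : 0 ≤ t ^ N := pow_nonneg ht.1 N
  have h1 : t ^ N ≤ 1 := pow_le_one₀ ht.1 ht.2
  have h2 := Real.abs_sin_le_one (2 * Real.pi * φ)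
  rw [cornerIm, abs_div, abs_of_pos Real.pi_pos, div_lt_one Real.pi_pos, abs_mul,
    abs_of_nonneg (by positivity)]
  have : 2 * t ^ N * |Real.sin (2 * Real.pi * φ)| ≤ 2 * 1 * 1 := by gcongr
  linarith [Real.pi_gt_three]

theorem corner_inj (hN : N ≠ 0) (ht : 0 ≤ t) (ht' : 0 ≤ t') (hφ : φ ∈ Icc (0 : ℝ) 1)
    (hφ' : φ' ∈ Icc (0 : ℝ) 1) (hre : cornerRe N t φ = cornerRe N t' φ')
    (him : cornerIm N t φ = cornerIm N t' φ') :
    t = t' ∧ (t = 0 ∨ φ = φ' ∨ (φ = 1 ∧ φ' = 0) ∨ (φ = 0 ∧ φ' = 1)) := by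
  have h := corner_eq N t φ
  rw [hre, him, corner_eq] at h
  have h1 := mul_left_cancel₀ two_ne_zero h
  have h2 : polar 1 (0 : Fin 1) (t' ^ N) φ' = polar 1 (0 : Fin 1) (t ^ N) φ := by
    have ha := polar_pow one_ne_zero (0 : Fin 1) (t ^ N) φ
    have hb := polar_pow one_ne_zero (0 : Fin 1) (t' ^ N) φ'
    rw [pow_one, pow_one] at ha hb
    rw [ha, hb]
    push_cast
    exact h1
  rw [polar_eq_polar_iff (pow_nonneg ht' N) (pow_nonneg ht N) hφ' hφ] at h2
  obtain ⟨h3, h4⟩ := h2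
  have h5 : t = t' := ((pow_left_inj₀ ht' ht hN).1 h3).symm
  refine ⟨h5, ?_⟩
  rcases h4 with h4 | ⟨-, h⟩ | ⟨h, h', -⟩ | ⟨h, h', -⟩
  · left
    rw [h5]
    exact (pow_eq_zero_iff hN).1 h4
  · exact Or.inr (Or.inl h.symm)
  · exact Or.inr (Or.inr (Or.inr ⟨h', h⟩))
  · exact Or.inr (Or.inr (Or.inl ⟨h', h⟩))

theorem eq_zero_of_corner (hN : N ≠ 0) (ht : 0 ≤ t) (hφ : φ ∈ Icc (0 : ℝ) 1)
    (hre : cornerRe N t φ = 0) (him : cornerIm N t φ = 0) : t = 0 := by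
  refine (corner_inj (t' := 0) (φ' := φ) hN ht le_rfl hφ hφ ?_ ?_).1
  · rw [hre]; simp [cornerRe, hN]
  · rw [him]; simp [cornerIm, hN]

theorem corner_of_zero (hN : N ≠ 0) (φ : ℝ) : cornerRe N 0 φ = 0 ∧ cornerIm N 0 φ = 0 := by
  simp [cornerRe, cornerIm, hN]

theorem angle_of_cornerIm_eq_zero (ht : t ≠ 0) (hφ : φ ∈ Icc (0 : ℝ) 1)
    (him : cornerIm N t φ = 0) : φ = 0 ∨ φ = 1 / 2 ∨ φ = 1 := by
  have h : Real.sin (2 * Real.pi * φ) = 0 := by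
    have h1 : 2 * t ^ N ≠ 0 := by positivity
    simpa [cornerIm, Real.pi_ne_zero, ht] using him
  obtain ⟨z, hz⟩ := Real.sin_eq_zero_iff.1 h
  have h2 : (z : ℝ) = 2 * φ := by
    have : Real.pi * z = Real.pi * (2 * φ) := by linarith
    exact mul_left_cancel₀ Real.pi_ne_zero this
  have h3 : 0 ≤ z := by
    have : (0 : ℝ) ≤ z := by linarith [hφ.1]
    exact_mod_cast this
  have h4 : z ≤ 2 := by
    have : (z : ℝ) ≤ 2 := by linarith [hφ.2]
    exact_mod_cast this
  interval_cases z
  · left; push_cast at h2; linarith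
  · right; left; push_cast at h2; linarith
  · right; right; push_cast at h2; linarith

theorem cornerRe_angle_zero (N : ℕ) (t : ℝ) : cornerRe N t 0 = 2 * t ^ N := by simp [cornerRe]

theorem cornerRe_angle_one (N : ℕ) (t : ℝ) : cornerRe N t 1 = 2 * t ^ N := by simp [cornerRe]

theorem cornerRe_angle_half (N : ℕ) (t : ℝ) : cornerRe N t (1 / 2) = -(2 * t ^ N) := by
  have harg : 2 * Real.pi * (1 / 2) = Real.pi := by ring
  rw [cornerRe, harg, Real.cos_pi]
  ring

theorem cornerIm_angle_zero (N : ℕ) (t : ℝ) : cornerIm N t 0 = 0 := by simp [cornerIm]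

theorem cornerIm_angle_one (N : ℕ) (t : ℝ) : cornerIm N t 1 = 0 := by simp [cornerIm]

theorem exists_corner_eq_of_im_nonneg (hN : N ≠ 0) {u θ : ℝ} (hθ : 0 ≤ θ)
    (h : ‖(u + Real.pi * θ * Complex.I : ℂ)‖ < 2) :
    ∃ t ∈ Ico (0 : ℝ) 1, ∃ φ ∈ Icc (0 : ℝ) (1 / 2), cornerRe N t φ = u ∧ cornerIm N t φ = θ := by
  set w : ℂ := u + Real.pi * θ * Complex.I with hw
  have him : w.im = Real.pi * θ := by simp [hw]
  have hre : w.re = u := by simp [hw]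
  have hn0 : 0 ≤ ‖w‖ / 2 := by positivity
  have harg : 2 * Real.pi * (w.arg / (2 * Real.pi)) = w.arg := by field_simp
  refine ⟨(‖w‖ / 2) ^ (N : ℝ)⁻¹, ⟨Real.rpow_nonneg hn0 _, Real.rpow_lt_one hn0 (by linarith)
    (by positivity)⟩, w.arg / (2 * Real.pi), ⟨?_, ?_⟩, ?_, ?_⟩
  · refine div_nonneg (Complex.arg_nonneg_iff.2 ?_) (by positivity)
    rw [him]; positivity
  · rw [div_le_iff₀ (by positivity)]
    linarith [Complex.arg_le_pi w]
  · rw [cornerRe, Real.rpow_inv_natCast_pow hn0 hN, harg, ← hre]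
    conv_rhs => rw [← Complex.norm_mul_cos_arg]
    ring
  · rw [cornerIm, Real.rpow_inv_natCast_pow hn0 hN, harg, div_eq_iff Real.pi_ne_zero, mul_comm θ,
      ← him]
    conv_rhs => rw [← Complex.norm_mul_sin_arg]
    ring

theorem exists_corner_eq_of_im_nonpos (hN : N ≠ 0) {u θ : ℝ} (hθ : θ ≤ 0)
    (h : ‖(u + Real.pi * θ * Complex.I : ℂ)‖ < 2) :
    ∃ t ∈ Ico (0 : ℝ) 1, ∃ φ ∈ Icc (1 / 2 : ℝ) 1, cornerRe N t φ = u ∧ cornerIm N t φ = θ := by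
  have h' : ‖(u + Real.pi * (-θ : ℝ) * Complex.I : ℂ)‖ < 2 := by
    rw [← Complex.norm_conj]
    convert h using 2
    simp [Complex.conj_ofReal]
  obtain ⟨t, ht, φ, hφ, h1, h2⟩ := exists_corner_eq_of_im_nonneg hN (neg_nonneg.2 hθ) h'
  have harg : 2 * Real.pi * (1 - φ) = 2 * Real.pi - 2 * Real.pi * φ := by ring
  refine ⟨t, ht, 1 - φ, ⟨by linarith [hφ.2], by linarith [hφ.1]⟩, ?_, ?_⟩
  · rw [cornerRe, harg, Real.cos_two_pi_sub]
    exact h1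
  · rw [cornerIm, harg, Real.sin_two_pi_sub, mul_neg, neg_div]
    rw [cornerIm] at h2
    rw [h2, neg_neg]

end Corner

/-! ### Discs around the vertices -/

namespace CellData

variable {V E : Type} {Face : Bool → Type} {len : Bool → ℕ} {N : ℕ} [∀ c, NeZero (len c)]
  [NeZero N] (M : CellData V E Face len N)

/-- The edge that enters the vertex `x` just after the outgoing edge with index `i`. -/
def inEdge (x : V) (i : Fin N) : E := (M.next true).symm (M.outEdge (x, i))

@[simp] theorem next_true_inEdge (x : V) (i : Fin N) :
    M.next true (M.inEdge x i) = M.outEdge (x, i) := by simp [inEdge]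

theorem next_false_inEdge (x : V) (i : Fin N) :
    M.next false (M.inEdge x i) = M.outEdge (x, i + 1) := (M.outEdge_succ x i).symm

theorem tgt_inEdge (x : V) (i : Fin N) : M.tgt (M.inEdge x i) = x := by
  rw [inEdge, tgt_eq_of_next_symm, src_outEdge]

theorem inEdge_ne_outEdge (x : V) (i i' : Fin N) : M.inEdge x i ≠ M.outEdge (x, i') := by
  intro h
  apply M.src_ne_tgt (M.inEdge x i)
  rw [M.tgt_inEdge, h, M.src_outEdge]

theorem outEdge_injective (x : V) {i i' : Fin N} (h : M.outEdge (x, i) = M.outEdge (x, i')) :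
    i = i' := congrArg Prod.snd (M.outEdge.injective h)

theorem inEdge_injective (x : V) {i i' : Fin N} (h : M.inEdge x i = M.inEdge x i') :
    i = i' := M.outEdge_injective x ((M.next true).symm.injective h)

theorem exists_outEdge_eq (e : E) : ∃ i, M.outEdge (M.src e, i) = e := by
  obtain ⟨⟨x, i⟩, rfl⟩ := M.outEdge.surjective e
  exact ⟨i, by rw [M.src_outEdge]⟩

theorem exists_inEdge_eq (e : E) : ∃ i, M.inEdge (M.tgt e) i = e := by
  obtain ⟨i, hi⟩ := M.exists_outEdge_eq (M.next true e)
  rw [M.src_next] at hi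
  exact ⟨i, by rw [inEdge, hi, Equiv.symm_apply_apply]⟩

/-- A neighbourhood of a vertex as a disc glued from sectors. -/
noncomputable def vertexMap (x : V) (a : Fin N × unitInterval × unitInterval) : M.Surface :=
  if (a.2.2 : ℝ) ≤ 1 / 2 then
    M.pt (M.outEdge (x, a.1)) (Real.tanh (cornerRe N a.2.1 a.2.2)) (cornerIm N a.2.1 a.2.2)
  else M.pt (M.inEdge x a.1) (Real.tanh (cornerRe N a.2.1 a.2.2)) (1 + cornerIm N a.2.1 a.2.2)

theorem vertexMap_of_le {x : V} {a : Fin N × unitInterval × unitInterval}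
    (h : (a.2.2 : ℝ) ≤ 1 / 2) : M.vertexMap x a =
    M.pt (M.outEdge (x, a.1)) (Real.tanh (cornerRe N a.2.1 a.2.2)) (cornerIm N a.2.1 a.2.2) :=
  if_pos h

/-- On the ray `φ = 1 / 2` one has `y ≤ 0`, the side of colour `true`, where the incoming edge is
followed by the outgoing edge of the same index; the two formulas therefore agree there. -/
theorem vertexMap_of_ge {x : V} {a : Fin N × unitInterval × unitInterval}
    (h : 1 / 2 ≤ (a.2.2 : ℝ)) : M.vertexMap x a =
    M.pt (M.inEdge x a.1) (Real.tanh (cornerRe N a.2.1 a.2.2)) (1 + cornerIm N a.2.1 a.2.2) := by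
  rcases h.eq_or_lt with h | h
  · rw [M.vertexMap_of_le h.ge]
    have harg : 2 * Real.pi * (1 / 2) = Real.pi := by ring
    have h1 : cornerIm N a.2.1 a.2.2 = 0 := by rw [cornerIm, ← h, harg]; simp
    have h2 : cornerRe N a.2.1 a.2.2 ≤ 0 := by
      have := pow_nonneg a.2.1.2.1 N
      rw [cornerRe, ← h, harg, Real.cos_pi]
      linarith
    rw [h1, add_zero, ← M.next_true_inEdge, M.pt_next (tanh_mem _)]
    rcases h2.eq_or_lt with h2 | h2
    · simp [h2]
    · have := tanh_neg_iff.2 h2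
      simp only [sgn, if_true]
      linarith
  · exact if_neg (not_le.2 h)

theorem continuous_vertexMap (x : V) : Continuous (M.vertexMap x) := by
  rw [continuous_prod_of_discrete_left]
  intro i
  have h1 : Continuous fun a : unitInterval × unitInterval => (a.1 : ℝ) :=
    continuous_subtype_val.comp continuous_fst
  have h2 : Continuous fun a : unitInterval × unitInterval => (a.2 : ℝ) :=
    continuous_subtype_val.comp continuous_snd
  have h3 : Continuous fun a : unitInterval × unitInterval => Real.tanh (cornerRe N a.1 a.2) := by
    refine continuous_real_tanh.comp ?_
    unfold cornerRe
    exact (continuous_const.mul (h1.pow N)).mul (Real.continuous_cos.comp (continuous_const.mul h2))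
  have h4 : Continuous fun a : unitInterval × unitInterval => cornerIm N a.1 a.2 := by
    unfold cornerIm
    exact ((continuous_const.mul (h1.pow N)).mul
      (Real.continuous_sin.comp (continuous_const.mul h2))).div_const _
  have h5 : Continuous fun a : unitInterval × unitInterval => 1 + cornerIm N a.1 a.2 :=
    continuous_const.add h4
  refine Continuous.if_le (M.continuous_pt (M.outEdge (x, i)) h3 h4)
    (M.continuous_pt (M.inEdge x i) h3 h5) h2 continuous_const ?_
  intro a ha
  have hle := M.vertexMap_of_le (x := x) (a := (i, a)) ha.le
  rw [M.vertexMap_of_ge (x := x) (a := (i, a)) ha.ge] at hle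
  exact hle.symm

end CellData

theorem cornerIm_mem_of_le {N : ℕ} {t φ : unitInterval} (h : (φ : ℝ) ≤ 1 / 2) :
    cornerIm N t φ ∈ Ico (0 : ℝ) 1 :=
  ⟨cornerIm_nonneg t.2.1 φ.2.1 h, (abs_lt.1 (abs_cornerIm_lt_one t.2)).2⟩

theorem one_add_cornerIm_mem_of_ge {N : ℕ} {t φ : unitInterval} (h : 1 / 2 ≤ (φ : ℝ)) :
    1 + cornerIm N t φ ∈ Ioc (0 : ℝ) 1 := by
  have h1 := (abs_lt.1 (abs_cornerIm_lt_one (N := N) (φ := φ) t.2)).1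
  have h2 := cornerIm_nonpos (N := N) t.2.1 h φ.2.2
  exact ⟨by linarith, by linarith⟩

namespace CellData

variable {V E : Type} {Face : Bool → Type} {len : Bool → ℕ} {N : ℕ} [∀ c, NeZero (len c)]
  [NeZero N] (M : CellData V E Face len N)

theorem sgn_mul_tanh_ne_one (c : Bool) (u : ℝ) : sgn c * Real.tanh u ≠ 1 := by
  have h1 := Real.neg_one_lt_tanh u
  have h2 := Real.tanh_lt_one u
  cases c <;> simp only [sgn] <;> norm_num <;> intro h <;> linarith

theorem faceCoord_true_eq_iff {a b : Fin N × unitInterval × unitInterval} :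
    faceCoord true N a = faceCoord true N b ↔
      (a.2.1 : ℝ) = b.2.1 ∧ ((a.2.1 : ℝ) = 0 ∨ SamePosition a.1 a.2.2 b.1 b.2.2) := by
  rw [faceCoord, faceCoord, (orient_injective true).eq_iff,
    polar_eq_polar_iff a.2.1.2.1 b.2.1.2.1 a.2.2.2 b.2.2.2]

/-- The parameter on an outgoing edge stays below `1` and that on an incoming edge above `0`, so far
ends never interfere. Besides the vertex itself, only the ray between incoming edge `i'` and
outgoing edge `i' + 1` remains; there `y > 0`, so the crossing is through a face of colour `false`.
The ray inside a face of colour `true` does not occur, being assigned to the outgoing half. -/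
theorem faceCoord_eq_of_rel_out_in {x : V} {i i' : Fin N} {t φ t' φ' : unitInterval}
    (hφ : (φ : ℝ) ≤ 1 / 2) (hφ' : 1 / 2 < (φ' : ℝ))
    (h : M.Rel (M.outEdge (x, i)) (Real.tanh (cornerRe N t φ)) (cornerIm N t φ)
      (M.inEdge x i') (Real.tanh (cornerRe N t' φ')) (1 + cornerIm N t' φ')) :
    faceCoord true N (i, t, φ) = faceCoord true N (i', t', φ') := by
  have hN : N ≠ 0 := NeZero.ne N
  have hm := cornerIm_mem_of_le (N := N) (t := t) hφ
  have hm' := one_add_cornerIm_mem_of_ge (N := N) (t := t') hφ'.le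
  obtain ⟨hy, h⟩ := h
  have hre := Real.tanh_injective hy
  rw [faceCoord_true_eq_iff]
  simp only
  rcases h with ⟨he, -⟩ | ⟨h0, x', hx, hx'⟩ | ⟨c, hc, -, h | ⟨h, -, -⟩ | ⟨h, h', he⟩⟩
  · exact absurd he.symm (M.inEdge_ne_outEdge x _ _)
  · rw [tanh_eq_zero_iff] at h0
    have h1 : cornerIm N t φ = 0 := by
      rcases hx with ⟨h, -⟩ | ⟨h, -⟩
      · exact h
      · exact absurd h hm.2.ne
    have h2 : cornerIm N t' φ' = 0 := by
      rcases hx' with ⟨h, -⟩ | ⟨h, -⟩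
      · exact absurd h hm'.1.ne'
      · linarith
    have ht := eq_zero_of_corner hN t.2.1 φ.2 h0 h1
    have ht' := eq_zero_of_corner hN t'.2.1 φ'.2 (hre ▸ h0) h2
    exact ⟨ht.trans ht'.symm, Or.inl ht⟩
  · exact absurd h (sgn_mul_tanh_ne_one _ _)
  · exact absurd h hm.2.ne
  · have him' : cornerIm N t' φ' = 0 := by linarith
    have hne : cornerRe N t' φ' ≠ 0 := by
      intro h0
      rw [hre, h0, Real.tanh_zero, mul_zero] at hc
      exact lt_irrefl _ hc
    have ht' : (t' : ℝ) ≠ 0 := fun h0 => hne (by rw [h0]; exact (corner_of_zero hN _).1)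
    have ht : (t : ℝ) ≠ 0 := fun h0 => hne (by rw [← hre, h0]; exact (corner_of_zero hN _).1)
    have hpos : 0 < (t : ℝ) ^ N := pow_pos (lt_of_le_of_ne t.2.1 ht.symm) N
    have hpos' : 0 < (t' : ℝ) ^ N := pow_pos (lt_of_le_of_ne t'.2.1 ht'.symm) N
    have hφ1 : (φ' : ℝ) = 1 := by
      rcases angle_of_cornerIm_eq_zero ht' φ'.2 him' with h1 | h1 | h1 <;> linarith
    have hre' : cornerRe N t' φ' = 2 * (t' : ℝ) ^ N := by rw [hφ1, cornerRe_angle_one]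
    have hφ0 : (φ : ℝ) = 0 := by
      rcases angle_of_cornerIm_eq_zero ht φ.2 h with h1 | h1 | h1
      · exact h1
      · rw [h1, cornerRe_angle_half, hre'] at hre
        linarith
      · linarith
    have htt : (t : ℝ) = t' := by
      rw [hφ0, cornerRe_angle_zero, hre'] at hre
      exact (pow_left_inj₀ t.2.1 t'.2.1 hN).1 (by linarith)
    refine ⟨htt, Or.inr (Or.inr (Or.inr ⟨hφ0, hφ1, ?_⟩))⟩
    -- At `φ' = 1` the real part is `2 * t' ^ N > 0`, so the point lies on the side of colour
    -- `false`.
    have hcf : c = false := by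
      refine eq_of_sgn_mul_pos hc ?_
      simp only [sgn, Bool.false_eq_true, if_false, one_mul, tanh_pos_iff, hre, hre']
      linarith
    rw [hcf, M.next_false_inEdge] at he
    exact M.outEdge_injective x he

theorem faceCoord_eq_of_rel_out_out {x : V} {i i' : Fin N} {t φ t' φ' : unitInterval}
    (hφ : (φ : ℝ) ≤ 1 / 2) (hφ' : (φ' : ℝ) ≤ 1 / 2)
    (h : M.Rel (M.outEdge (x, i)) (Real.tanh (cornerRe N t φ)) (cornerIm N t φ)
      (M.outEdge (x, i')) (Real.tanh (cornerRe N t' φ')) (cornerIm N t' φ')) :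
    faceCoord true N (i, t, φ) = faceCoord true N (i', t', φ') := by
  have hN : N ≠ 0 := NeZero.ne N
  have hm := cornerIm_mem_of_le (N := N) (t := t) hφ
  have hm' := cornerIm_mem_of_le (N := N) (t := t') hφ'
  obtain ⟨hy, h⟩ := h
  have hre := Real.tanh_injective hy
  rw [faceCoord_true_eq_iff]
  simp only
  rcases h with ⟨he, him⟩ | ⟨h0, x', hx, hx'⟩ | ⟨c, hc, -, h | ⟨h, -, -⟩ | ⟨-, h, -⟩⟩
  · obtain ⟨h1, h2⟩ := corner_inj hN t.2.1 t'.2.1 φ.2 φ'.2 hre him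
    refine ⟨h1, ?_⟩
    rcases h2 with h2 | h2 | h2 | h2
    · exact Or.inl h2
    · exact Or.inr (Or.inl ⟨M.outEdge_injective x he, h2⟩)
    · linarith
    · linarith
  · rw [tanh_eq_zero_iff] at h0
    have h1 : cornerIm N t φ = 0 := by
      rcases hx with ⟨h, -⟩ | ⟨h, -⟩
      · exact h
      · exact absurd h hm.2.ne
    have h2 : cornerIm N t' φ' = 0 := by
      rcases hx' with ⟨h, -⟩ | ⟨h, -⟩
      · exact h
      · exact absurd h hm'.2.ne
    have ht := eq_zero_of_corner hN t.2.1 φ.2 h0 h1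
    have ht' := eq_zero_of_corner hN t'.2.1 φ'.2 (hre ▸ h0) h2
    exact ⟨ht.trans ht'.symm, Or.inl ht⟩
  · exact absurd h (sgn_mul_tanh_ne_one _ _)
  · exact absurd h hm.2.ne
  · exact absurd h hm'.2.ne

theorem faceCoord_eq_of_rel_in_in {x : V} {i i' : Fin N} {t φ t' φ' : unitInterval}
    (hφ : 1 / 2 < (φ : ℝ)) (hφ' : 1 / 2 < (φ' : ℝ))
    (h : M.Rel (M.inEdge x i) (Real.tanh (cornerRe N t φ)) (1 + cornerIm N t φ)
      (M.inEdge x i') (Real.tanh (cornerRe N t' φ')) (1 + cornerIm N t' φ')) :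
    faceCoord true N (i, t, φ) = faceCoord true N (i', t', φ') := by
  have hN : N ≠ 0 := NeZero.ne N
  have hm := one_add_cornerIm_mem_of_ge (N := N) (t := t) hφ.le
  have hm' := one_add_cornerIm_mem_of_ge (N := N) (t := t') hφ'.le
  obtain ⟨hy, h⟩ := h
  have hre := Real.tanh_injective hy
  rw [faceCoord_true_eq_iff]
  simp only
  rcases h with ⟨he, him⟩ | ⟨h0, x', hx, hx'⟩ | ⟨c, hc, -, h | ⟨-, h, -⟩ | ⟨h, -, -⟩⟩
  · obtain ⟨h1, h2⟩ := corner_inj hN t.2.1 t'.2.1 φ.2 φ'.2 hre (add_left_cancel him)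
    refine ⟨h1, ?_⟩
    rcases h2 with h2 | h2 | h2 | h2
    · exact Or.inl h2
    · exact Or.inr (Or.inl ⟨M.inEdge_injective x he, h2⟩)
    · linarith
    · linarith
  · rw [tanh_eq_zero_iff] at h0
    have h1 : cornerIm N t φ = 0 := by
      rcases hx with ⟨h, -⟩ | ⟨h, -⟩
      · exact absurd h hm.1.ne'
      · linarith
    have h2 : cornerIm N t' φ' = 0 := by
      rcases hx' with ⟨h, -⟩ | ⟨h, -⟩
      · exact absurd h hm'.1.ne'
      · linarith
    have ht := eq_zero_of_corner hN t.2.1 φ.2 h0 h1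
    have ht' := eq_zero_of_corner hN t'.2.1 φ'.2 (hre ▸ h0) h2
    exact ⟨ht.trans ht'.symm, Or.inl ht⟩
  · exact absurd h (sgn_mul_tanh_ne_one _ _)
  · exact absurd h hm'.1.ne'
  · exact hm.1.ne h.symm |>.elim

/-- Every point of the disc around a vertex, in terms of the lozenge that contains it. -/
theorem vertexMap_cases (x : V) (i : Fin N) (t φ : unitInterval) :
    ((φ : ℝ) ≤ 1 / 2 ∧ cornerIm N t φ ∈ Icc (0 : ℝ) 1 ∧ M.vertexMap x (i, t, φ) =
      M.pt (M.outEdge (x, i)) (Real.tanh (cornerRe N t φ)) (cornerIm N t φ)) ∨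
    (1 / 2 < (φ : ℝ) ∧ 1 + cornerIm N t φ ∈ Icc (0 : ℝ) 1 ∧ M.vertexMap x (i, t, φ) =
      M.pt (M.inEdge x i) (Real.tanh (cornerRe N t φ)) (1 + cornerIm N t φ)) := by
  rcases le_or_gt (φ : ℝ) (1 / 2) with h | h
  · exact Or.inl ⟨h, Ico_subset_Icc_self (cornerIm_mem_of_le h), M.vertexMap_of_le h⟩
  · exact Or.inr ⟨h, Ioc_subset_Icc_self (one_add_cornerIm_mem_of_ge h.le), M.vertexMap_of_ge h.le⟩

theorem vertexMap_center (x : V) (i : Fin N) {t φ : unitInterval} (ht : (t : ℝ) = 0) :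
    ∃ e θ, θ ∈ Icc (0 : ℝ) 1 ∧ M.IsEnd e θ x ∧ M.vertexMap x (i, t, φ) = M.pt e 0 θ := by
  obtain ⟨h1, h2⟩ := corner_of_zero (N := N) (NeZero.ne N) φ
  rcases M.vertexMap_cases x i t φ with ⟨-, -, h⟩ | ⟨-, -, h⟩ <;> rw [h, ht, h1, h2, Real.tanh_zero]
  · exact ⟨_, 0, by simp, Or.inl ⟨rfl, M.src_outEdge x i⟩, rfl⟩
  · exact ⟨_, 1, by simp, Or.inr ⟨rfl, M.tgt_inEdge x i⟩, by rw [add_zero]⟩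

/-- The common ray lies in `y ≥ 0`, where the gluing along `next false` takes incoming edge `i` to
outgoing edge `i + 1`. The cyclic order of the edges around the vertex enters here. -/
theorem vertexMap_succ (x : V) (i : Fin N) (t : unitInterval) :
    M.vertexMap x (i + 1, t, 0) = M.vertexMap x (i, t, 1) := by
  have h0 : (0 : ℝ) ≤ (t : ℝ) ^ N := pow_nonneg t.2.1 N
  rw [M.vertexMap_of_le (by simp), M.vertexMap_of_ge (by simp; norm_num)]
  simp only [Icc.coe_zero, Icc.coe_one, cornerRe_angle_zero, cornerRe_angle_one,
    cornerIm_angle_zero, cornerIm_angle_one, add_zero]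
  rw [← M.next_false_inEdge, M.pt_next (tanh_mem _)]
  simp only [sgn, Bool.false_eq_true, if_false, one_mul]
  rcases h0.eq_or_lt with h | h
  · simp [← h]
  · exact (tanh_pos_iff.2 (by linarith)).le

theorem vertexMap_eq_iff (x : V) (a b : Fin N × unitInterval × unitInterval) :
    M.vertexMap x a = M.vertexMap x b ↔ faceCoord true N a = faceCoord true N b := by
  obtain ⟨i, t, φ⟩ := a
  obtain ⟨i', t', φ'⟩ := b
  constructor
  · intro h
    rcases M.vertexMap_cases x i t φ with ⟨h1, h2, h3⟩ | ⟨h1, h2, h3⟩ <;>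
    rcases M.vertexMap_cases x i' t' φ' with ⟨h1', h2', h3'⟩ | ⟨h1', h2', h3'⟩ <;>
    rw [h3, h3'] at h
    · rw [M.pt_eq_pt_iff (tanh_mem _) (tanh_mem _) h2 h2'] at h
      exact M.faceCoord_eq_of_rel_out_out h1 h1' h
    · rw [M.pt_eq_pt_iff (tanh_mem _) (tanh_mem _) h2 h2'] at h
      exact M.faceCoord_eq_of_rel_out_in h1 h1' h
    · have h := h.symm
      rw [M.pt_eq_pt_iff (tanh_mem _) (tanh_mem _) h2' h2] at h
      exact (M.faceCoord_eq_of_rel_out_in h1' h1 h).symm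
    · rw [M.pt_eq_pt_iff (tanh_mem _) (tanh_mem _) h2 h2'] at h
      exact M.faceCoord_eq_of_rel_in_in h1 h1' h
  · rw [faceCoord_true_eq_iff]
    dsimp only
    rintro ⟨htt, h⟩
    obtain rfl := Subtype.ext htt
    rcases h with h | ⟨rfl, h⟩ | ⟨h1, h2, rfl⟩ | ⟨h1, h2, rfl⟩
    · obtain ⟨e, θ, hθ, he, h1⟩ := M.vertexMap_center x i (φ := φ) h
      obtain ⟨e', θ', hθ', he', h1'⟩ := M.vertexMap_center x i' (φ := φ') h
      rw [h1, h1', M.pt_eq_pt_iff (by simp) (by simp) hθ hθ']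
      exact ⟨rfl, Or.inr (Or.inl ⟨rfl, x, he, he'⟩)⟩
    · obtain rfl := Subtype.ext h
      rfl
    · obtain rfl : φ = 1 := Subtype.ext h1
      obtain rfl : φ' = 0 := Subtype.ext h2
      exact (M.vertexMap_succ x i t).symm
    · obtain rfl : φ = 0 := Subtype.ext h1
      obtain rfl : φ' = 1 := Subtype.ext h2
      exact M.vertexMap_succ x _ t

/-- The lozenge coordinates of the points near a vertex. -/
def Near (x : V) (e : E) (y θ : ℝ) : Prop :=
  y ∈ Ioo (-1 : ℝ) 1 ∧
    ((M.src e = x ∧ ‖(Real.artanh y + Real.pi * θ * Complex.I : ℂ)‖ < 2) ∨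
      (M.tgt e = x ∧ ‖(Real.artanh y + Real.pi * (θ - 1 : ℝ) * Complex.I : ℂ)‖ < 2))

/-- The imaginary part alone has modulus at least `π > 2`; thus only one alternative of `Near` can
hold at either end of an edge. -/
theorem not_norm_add_pi_lt {u θ : ℝ} (hθ : 1 ≤ |θ|) :
    ¬ ‖(u + Real.pi * θ * Complex.I : ℂ)‖ < 2 := by
  intro h
  have h1 := Complex.abs_im_le_norm (u + Real.pi * θ * Complex.I : ℂ)
  have h2 : (u + Real.pi * θ * Complex.I : ℂ).im = Real.pi * θ := by simp
  rw [h2, abs_mul, abs_of_pos Real.pi_pos] at h1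
  nlinarith [Real.pi_gt_three]

theorem near_zero_iff {x : V} {e : E} {y : ℝ} : M.Near x e y 0 ↔
    y ∈ Ioo (-1 : ℝ) 1 ∧ M.src e = x ∧ |Real.artanh y| < 2 := by
  have h := not_norm_add_pi_lt (u := Real.artanh y) (θ := 0 - 1) (by simp)
  unfold Near
  simp only [h, and_false, or_false]
  simp

theorem near_one_iff {x : V} {e : E} {y : ℝ} : M.Near x e y 1 ↔
    y ∈ Ioo (-1 : ℝ) 1 ∧ M.tgt e = x ∧ |Real.artanh y| < 2 := by
  have h := not_norm_add_pi_lt (u := Real.artanh y) (θ := 1) (by simp)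
  unfold Near
  simp only [h, and_false, false_or]
  simp

theorem near_of_isEnd {x x' : V} {e : E} {θ : ℝ} (h : M.IsEnd e θ x') :
    M.Near x e 0 θ ↔ x' = x := by
  rcases h with ⟨rfl, rfl⟩ | ⟨rfl, rfl⟩
  · rw [near_zero_iff]; simp
  · rw [near_one_iff]; simp

/-- Nearness to a vertex depends on the point of the surface and not on the lozenge used to describe
it. Centres of faces are never near a vertex. -/
theorem near_iff_of_rel {x : V} {e e' : E} {y y' θ θ' : ℝ} (h : M.Rel e y θ e' y' θ') :
    M.Near x e y θ ↔ M.Near x e' y' θ' := by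
  obtain ⟨rfl, ⟨rfl, rfl⟩ | ⟨rfl, x', hx, hx'⟩ | ⟨c, hc, hf, h | ⟨rfl, rfl, rfl⟩ | ⟨rfl, rfl, rfl⟩⟩⟩ := h
  · rfl
  · rw [M.near_of_isEnd hx, M.near_of_isEnd hx']
  · have hy : y ∉ Ioo (-1 : ℝ) 1 := by
      rintro ⟨h1, h2⟩
      cases c <;> simp [sgn] at h <;> linarith
    simp [Near, hy]
  · rw [near_one_iff, near_zero_iff, M.src_next]
  · rw [near_one_iff, near_zero_iff, M.src_next]

/-- The open disc around a vertex. -/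
def vertexDisc (x : V) : Set M.Surface := M.vertexMap x '' (faceCoord true N ⁻¹' ball 0 1)

theorem pt_mem_vertexDisc {x : V} {e : E} {y θ : ℝ} (hy : y ∈ Icc (-1 : ℝ) 1)
    (hθ : θ ∈ Icc (0 : ℝ) 1) : M.pt e y θ ∈ M.vertexDisc x ↔ M.Near x e y θ := by
  have hN : N ≠ 0 := NeZero.ne N
  constructor
  · rintro ⟨⟨i, t, φ⟩, ha, h⟩
    have ht : (t : ℝ) < 1 := by simpa [norm_faceCoord] using ha
    have hn : ‖(cornerRe N t φ + Real.pi * cornerIm N t φ * Complex.I : ℂ)‖ < 2 := by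
      rw [corner_eq]
      have h1 := norm_polar (n := 1) 0 (pow_nonneg t.2.1 N) φ
      have h2 := polar_pow one_ne_zero 0 ((t : ℝ) ^ N) φ
      rw [pow_one, pow_one] at h2
      push_cast at h2
      rw [← h2, norm_mul, h1, Complex.norm_ofNat]
      have := pow_lt_one₀ t.2.1 ht hN
      linarith
    have hIoo : Real.tanh (cornerRe N t φ) ∈ Ioo (-1 : ℝ) 1 :=
      ⟨Real.neg_one_lt_tanh _, Real.tanh_lt_one _⟩
    rcases M.vertexMap_cases x i t φ with ⟨h1, h2, h3⟩ | ⟨h1, h2, h3⟩ <;>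
      rw [h3, M.pt_eq_pt_iff (tanh_mem _) hy h2 hθ] at h <;> rw [← M.near_iff_of_rel h]
    · refine ⟨hIoo, Or.inl ⟨M.src_outEdge x i, ?_⟩⟩
      rw [Real.artanh_tanh]
      exact hn
    · refine ⟨hIoo, Or.inr ⟨M.tgt_inEdge x i, ?_⟩⟩
      rw [Real.artanh_tanh, add_sub_cancel_left]
      exact hn
  · rintro ⟨hIoo, ⟨rfl, h⟩ | ⟨rfl, h⟩⟩
    · obtain ⟨i, hi⟩ := M.exists_outEdge_eq e
      obtain ⟨t, ht, φ, hφ, h1, h2⟩ := exists_corner_eq_of_im_nonneg hN hθ.1 h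
      refine ⟨(i, ⟨t, ht.1, ht.2.le⟩, ⟨φ, hφ.1, by linarith [hφ.2]⟩), ?_, ?_⟩
      · simpa [norm_faceCoord] using ht.2
      · rw [M.vertexMap_of_le hφ.2]
        simp only [hi, h1, h2, Real.tanh_artanh hIoo]
    · obtain ⟨i, hi⟩ := M.exists_inEdge_eq e
      obtain ⟨t, ht, φ, hφ, h1, h2⟩ :=
        exists_corner_eq_of_im_nonpos hN (by linarith [hθ.2] : θ - 1 ≤ 0) h
      refine ⟨(i, ⟨t, ht.1, ht.2.le⟩, ⟨φ, by linarith [hφ.1], hφ.2⟩), ?_, ?_⟩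
      · simpa [norm_faceCoord] using ht.2
      · rw [M.vertexMap_of_ge hφ.1]
        simp only [hi, h1, h2, Real.tanh_artanh hIoo, add_sub_cancel]

theorem isOpen_vertexDisc [Finite E] (x : V) : IsOpen (M.vertexDisc x) := by
  refine M.isOpen_of_preimage_lozenge fun e => ?_
  have h : M.lozenge e ⁻¹' M.vertexDisc x = {a | M.Near x e a.1 a.2} := by
    ext a
    exact M.pt_mem_vertexDisc a.1.2 a.2.2
  rw [h]
  set O : Set (Icc (-1 : ℝ) 1 × Icc (0 : ℝ) 1) := {a | (a.1 : ℝ) ∈ Ioo (-1 : ℝ) 1} with hO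
  have h1 : Continuous fun a : Icc (-1 : ℝ) 1 × Icc (0 : ℝ) 1 => (a.1 : ℝ) :=
    continuous_subtype_val.comp continuous_fst
  have h2 : Continuous fun a : Icc (-1 : ℝ) 1 × Icc (0 : ℝ) 1 => (a.2 : ℝ) :=
    continuous_subtype_val.comp continuous_snd
  have hOo : IsOpen O := isOpen_Ioo.preimage h1
  have hart : ContinuousOn (fun a : Icc (-1 : ℝ) 1 × Icc (0 : ℝ) 1 => Real.artanh a.1) O :=
    continuousOn_artanh.comp h1.continuousOn fun a ha => ha
  -- Used with `f θ = θ` for the start of the edge and `f θ = θ - 1` for its end; `artanh` is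
  -- continuous only for `|y| < 1`, whence the restriction to `O`.
  have key : ∀ f : ℝ → ℝ, Continuous f →
      IsOpen (O ∩ {a | ‖(Real.artanh a.1 + Real.pi * f a.2 * Complex.I : ℂ)‖ < 2}) := by
    intro f hf
    have hf2 : Continuous fun a : Icc (-1 : ℝ) 1 × Icc (0 : ℝ) 1 =>
        (Real.pi * f a.2 * Complex.I : ℂ) :=
      (continuous_const.mul (Complex.continuous_ofReal.comp (hf.comp h2))).mul continuous_const
    have hc : ContinuousOn (fun a : Icc (-1 : ℝ) 1 × Icc (0 : ℝ) 1 =>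
        ‖(Real.artanh a.1 + Real.pi * f a.2 * Complex.I : ℂ)‖) O :=
      ((Complex.continuous_ofReal.comp_continuousOn hart).add hf2.continuousOn).norm
    exact hc.isOpen_inter_preimage hOo isOpen_Iio
  have hset : {a : Icc (-1 : ℝ) 1 × Icc (0 : ℝ) 1 | M.Near x e a.1 a.2} =
      ({_a | M.src e = x} ∩ (O ∩ {a | ‖(Real.artanh a.1 + Real.pi * (id a.2.1 : ℝ) * Complex.I : ℂ)‖ < 2})) ∪
      ({_a | M.tgt e = x} ∩
        (O ∩ {a | ‖(Real.artanh a.1 + Real.pi * ((fun r : ℝ => r - 1) a.2 : ℝ) * Complex.I : ℂ)‖ < 2})) := by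
    ext a
    simp only [Near, hO, mem_union, mem_inter_iff, mem_ofPred_eq, id]
    tauto
  rw [hset]
  exact (isOpen_const.inter (key id continuous_id)).union
    (isOpen_const.inter (key (fun r => r - 1) (by fun_prop)))

theorem exists_vertexChart [Finite E] (x : V) : ∃ ch : OpenPartialHomeomorph M.Surface ℂ,
    ch.source = M.vertexDisc x ∧ ch.target = ball 0 1 ∧
      ∀ a, ch (M.vertexMap x a) = faceCoord true N a :=
  exists_disc_chart (M.continuous_vertexMap x) (continuous_faceCoord true N)
    (M.vertexMap_eq_iff x) (ball_subset_range_faceCoord true N) (M.isOpen_vertexDisc x)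

end CellData

namespace CellData

variable {V E : Type} {Face : Bool → Type} {len : Bool → ℕ} {N : ℕ} [∀ c, NeZero (len c)]
  [NeZero N] (M : CellData V E Face len N)

/-! #### The oriented atlas -/

/-- The branched covering of the sphere by the surface, with a junk value at the points over `∞`. -/
noncomputable def sphereMap (q : M.Surface) : ℂ :=
  developing (M.exists_pt_eq q).choose_spec.choose
    (M.exists_pt_eq q).choose_spec.choose_spec.2.choose

theorem sphereMap_pt {e : E} {y θ : ℝ} (hy : y ∈ Icc (-1 : ℝ) 1) (hθ : θ ∈ Icc (0 : ℝ) 1) :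
    M.sphereMap (M.pt e y θ) = developing y θ := by
  have h := M.exists_pt_eq (M.pt e y θ)
  have h1 := h.choose_spec.choose_spec.1
  have h2 := h.choose_spec.choose_spec.2.choose_spec.1
  have h3 := h.choose_spec.choose_spec.2.choose_spec.2
  rw [M.pt_eq_pt_iff h1 hy h2 hθ] at h3
  exact M.developing_eq_of_rel h3

/-- The charts, centred at the faces and at the vertices. -/
noncomputable def chart [Finite E] : (Σ c, Face c) ⊕ V → OpenPartialHomeomorph M.Surface ℂ
  | Sum.inl F => (M.exists_faceChart F.1 F.2).choose
  | Sum.inr x => (M.exists_vertexChart x).choose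

/-- The map to the sphere in terms of the coordinate of a chart. -/
noncomputable def localMap (_M : CellData V E Face len N) : (Σ c, Face c) ⊕ V → ℂ → ℂ
  | Sum.inl F => fun w => if F.1 then w ^ len F.1 else (w ^ len F.1)⁻¹
  | Sum.inr _ => fun w => Complex.exp (4 * w ^ N)

/-- The coordinates on faces and around vertices were chosen so that the covering of the sphere
becomes a power, an inverse power or the exponential of a power. -/
theorem localMap_chart [Finite E] {i : (Σ c, Face c) ⊕ V} {q : M.Surface}
    (hq : q ∈ (M.chart i).source) : M.localMap i (M.chart i q) = M.sphereMap q := by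
  rcases i with ⟨c, F⟩ | x
  · obtain ⟨h1, h2, h3⟩ := (M.exists_faceChart c F).choose_spec
    change q ∈ (M.exists_faceChart c F).choose.source at hq
    rw [h1, ← M.faceMap_image_ball] at hq
    obtain ⟨a, -, rfl⟩ := hq
    change M.localMap _ ((M.exists_faceChart c F).choose (M.faceMap c F a)) = _
    rw [h3, faceMap, M.sphereMap_pt (sgn_mul_mem (radial_mem a.2.1.2)) a.2.2.2, developing_faceMap]
    rfl
  · obtain ⟨h1, h2, h3⟩ := (M.exists_vertexChart x).choose_spec
    change q ∈ (M.exists_vertexChart x).choose.source at hq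
    rw [h1] at hq
    obtain ⟨⟨i, t, φ⟩, -, rfl⟩ := hq
    change M.localMap _ ((M.exists_vertexChart x).choose (M.vertexMap x (i, t, φ))) = _
    rw [h3]
    -- The value is `exp (2 * (u + iπθ))`, and `u + iπθ = 2 * w ^ N` by `corner_eq`.
    have hdev : developing (Real.tanh (cornerRe N t φ)) (cornerIm N t φ) =
        Complex.exp (4 * faceCoord true N (i, t, φ) ^ N) := by
      have h4 : faceCoord true N (i, t, φ) ^ N = t ^ N * Complex.exp (2 * Real.pi * Complex.I * φ) := by
        simpa [faceCoord, orient] using polar_pow (NeZero.ne N) i (t : ℝ) (φ : ℝ)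
      rw [developing, one_add_tanh_div_one_sub_tanh, h4, Complex.ofReal_exp, ← Complex.exp_add]
      congr 1
      have := corner_eq N t φ
      calc _ = 2 * (cornerRe N t φ + Real.pi * cornerIm N t φ * Complex.I : ℂ) := by push_cast; ring
        _ = _ := by rw [this]; ring
    rcases M.vertexMap_cases x i t φ with ⟨h5, h6, h7⟩ | ⟨h5, h6, h7⟩ <;>
      rw [h7, M.sphereMap_pt (tanh_mem _) h6]
    · exact hdev.symm
    -- On the incoming half the parameter is shifted by `1`, a full period of the exponential.
    · have h8 : developing (Real.tanh (cornerRe N t φ)) (1 + cornerIm N t φ) =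
          developing (Real.tanh (cornerRe N t φ)) (cornerIm N t φ) := by
        rw [developing, developing]
        congr 1
        rw [Complex.exp_eq_exp_iff_exists_int]
        exact ⟨1, by push_cast; ring⟩
      rw [h8]
      exact hdev.symm

theorem hasStrictDerivAt_localMap (i : (Σ c, Face c) ⊕ V) {w : ℂ} (hw : w ≠ 0) :
    ∃ a ≠ 0, HasStrictDerivAt (M.localMap i) a w := by
  have hpow : ∀ n : ℕ, HasStrictDerivAt (fun w : ℂ => w ^ n) (n * w ^ (n - 1)) w := fun n =>
    hasStrictDerivAt_pow n w
  rcases i with ⟨c, F⟩ | x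
  · have hn : (len c : ℂ) ≠ 0 := by exact_mod_cast NeZero.ne (len c)
    cases c
    · have hw' := pow_ne_zero (len false) hw
      exact ⟨_, mul_ne_zero (neg_ne_zero.2 (inv_ne_zero (pow_ne_zero 2 hw')))
        (mul_ne_zero hn (pow_ne_zero _ hw)), (hasStrictDerivAt_inv hw').comp w (hpow (len false))⟩
    · exact ⟨_, mul_ne_zero hn (pow_ne_zero _ hw), hpow (len true)⟩
  · have hn : (N : ℂ) ≠ 0 := by exact_mod_cast NeZero.ne N
    exact ⟨_, mul_ne_zero (Complex.exp_ne_zero _) (mul_ne_zero (by norm_num)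
      (mul_ne_zero hn (pow_ne_zero _ hw))), ((hpow N).const_mul 4).cexp⟩

theorem eq_zero_of_faceCoord_eq_zero {c : Bool} {n : ℕ} {a : Fin n × unitInterval × unitInterval}
    (h : faceCoord c n a = 0) : (a.2.1 : ℝ) = 0 := by
  rw [← norm_faceCoord c n a, h, norm_zero]

/-- The branch points are avoided on overlaps: distinct open faces are disjoint, a face centre has
`|y| = 1` and so is near no vertex, and a vertex lies in no open face and in no other vertex disc.
-/
theorem chart_ne_zero [Finite E] {i j : (Σ c, Face c) ⊕ V} (hij : i ≠ j) {q : M.Surface}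
    (hi : q ∈ (M.chart i).source) (hj : q ∈ (M.chart j).source) : M.chart i q ≠ 0 := by
  have hface : ∀ c F, (M.chart (Sum.inl ⟨c, F⟩)).source = M.openFace c F := fun c F =>
    (M.exists_faceChart c F).choose_spec.1
  have hvert : ∀ x, (M.chart (Sum.inr x)).source = M.vertexDisc x := fun x =>
    (M.exists_vertexChart x).choose_spec.1
  intro h0
  rcases i with ⟨c, F⟩ | x
  · rw [hface] at hi
    rcases j with ⟨c', F'⟩ | x'
    · rw [hface] at hj
      exact hij (congrArg Sum.inl (M.eq_of_mem_openFace hi hj))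
    · rw [hvert] at hj
      rw [← M.faceMap_image_ball] at hi
      obtain ⟨a, -, rfl⟩ := hi
      have h1 : faceCoord c (len c) a = 0 :=
        ((M.exists_faceChart c F).choose_spec.2.2 a).symm.trans h0
      have h2 := eq_zero_of_faceCoord_eq_zero h1
      rw [faceMap, M.pt_mem_vertexDisc (sgn_mul_mem (radial_mem a.2.1.2)) a.2.2.2, h2,
        radial_zero (NeZero.ne _)] at hj
      obtain ⟨⟨h3, h4⟩, -⟩ := hj
      cases c <;> simp [sgn] at h3 h4
  · rw [hvert] at hi
    obtain ⟨⟨i, t, φ⟩, -, rfl⟩ := hi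
    have h1 : faceCoord true N (i, t, φ) = 0 :=
      ((M.exists_vertexChart x).choose_spec.2.2 (i, t, φ)).symm.trans h0
    obtain ⟨e, θ, hθ, he, h2⟩ := M.vertexMap_center x i (φ := φ) (eq_zero_of_faceCoord_eq_zero h1)
    rw [h2] at hj
    rcases j with ⟨c', F'⟩ | x'
    · rw [hface, M.pt_mem_openFace (by simp) hθ] at hj
      simp at hj
    · rw [hvert, M.pt_mem_vertexDisc (by simp) hθ, M.near_of_isEnd he] at hj
      exact hij (congrArg Sum.inr hj)

theorem exists_mem_chart_source [Finite E] (q : M.Surface) : ∃ i, q ∈ (M.chart i).source := by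
  obtain ⟨e, y, hy, θ, hθ, rfl⟩ := M.exists_pt_eq q
  by_cases h0 : y = 0
  · subst h0
    -- Each half of an edge lies in the disc of its own end because `π / 2 < 2`.
    rcases le_total θ (1 / 2) with h | h
    · refine ⟨Sum.inr (M.src e), ?_⟩
      rw [chart, (M.exists_vertexChart _).choose_spec.1, M.pt_mem_vertexDisc hy hθ]
      refine ⟨by norm_num, Or.inl ⟨rfl, ?_⟩⟩
      simp only [Real.artanh_zero, Complex.ofReal_zero, zero_add, norm_mul, Complex.norm_I, mul_one,
        Complex.norm_real, Real.norm_eq_abs, abs_of_pos Real.pi_pos]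
      rw [abs_of_nonneg hθ.1]
      nlinarith [Real.pi_pos, Real.pi_lt_four]
    · refine ⟨Sum.inr (M.tgt e), ?_⟩
      rw [chart, (M.exists_vertexChart _).choose_spec.1, M.pt_mem_vertexDisc hy hθ]
      refine ⟨by norm_num, Or.inr ⟨rfl, ?_⟩⟩
      simp only [Real.artanh_zero, Complex.ofReal_zero, zero_add, norm_mul, Complex.norm_I, mul_one,
        Complex.norm_real, Real.norm_eq_abs, abs_of_pos Real.pi_pos]
      rw [abs_of_nonpos (by linarith [hθ.2])]
      nlinarith [Real.pi_pos, Real.pi_lt_four]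
  · obtain ⟨c, hc⟩ := exists_sgn_mul_pos h0
    refine ⟨Sum.inl ⟨c, M.faceOf c e⟩, ?_⟩
    rw [chart, (M.exists_faceChart _ _).choose_spec.1, M.pt_mem_openFace hy hθ]
    exact ⟨rfl, hc⟩

theorem isOrientableSurface [Finite E] [ConnectedSpace M.Surface] :
    IsOrientableSurface M.Surface where
  t2 := inferInstance
  compact := inferInstance
  connected := inferInstance
  exists_oriented_atlas := by
    refine ⟨range M.chart, fun q => ?_, ?_⟩
    · obtain ⟨i, hi⟩ := M.exists_mem_chart_source q
      exact ⟨_, ⟨i, rfl⟩, hi⟩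
    rintro _ ⟨i, rfl⟩ _ ⟨j, rfl⟩
    by_cases hij : i = j
    · subst hij
      exact contDiffOn_det_pos_symm_trans_self _
    have hmem : ∀ w ∈ ((M.chart i).symm.trans (M.chart j)).source, ∃ q ∈ (M.chart i).source,
        q ∈ (M.chart j).source ∧ M.chart i q = w ∧
          ((M.chart i).symm.trans (M.chart j)) w = M.chart j q := by
      intro w hw
      rw [OpenPartialHomeomorph.trans_source, OpenPartialHomeomorph.symm_source] at hw
      exact ⟨(M.chart i).symm w, (M.chart i).map_target hw.1, hw.2, (M.chart i).right_inv hw.1, rfl⟩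
    refine contDiffOn_det_pos_of_comp_eq _ (F := M.localMap i) (F' := M.localMap j) ?_ ?_ ?_ <;>
      intro w hw <;> obtain ⟨q, h1, h2, h3, h4⟩ := hmem w hw
    · rw [← h3]
      exact M.hasStrictDerivAt_localMap i (M.chart_ne_zero hij h1 h2)
    · rw [h4]
      exact M.hasStrictDerivAt_localMap j (M.chart_ne_zero (Ne.symm hij) h2 h1)
    · rw [h4, ← h3, M.localMap_chart h1, M.localMap_chart h2]

/-! #### Faces and their boundaries -/

/-- The point of a vertex. -/
noncomputable def vertexPoint (x : V) : M.Surface := M.pt (M.outEdge (x, 0)) 0 0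

theorem pt_eq_vertexPoint {e : E} {θ : ℝ} {x : V} (h : M.IsEnd e θ x) :
    M.pt e 0 θ = M.vertexPoint x := by
  have hθ : θ ∈ Icc (0 : ℝ) 1 := by rcases h with ⟨rfl, -⟩ | ⟨rfl, -⟩ <;> simp
  rw [vertexPoint, M.pt_eq_pt_iff (by simp) (by simp) hθ (by simp)]
  exact ⟨rfl, Or.inr (Or.inl ⟨rfl, x, h, Or.inl ⟨rfl, M.src_outEdge x 0⟩⟩)⟩

/-- The union of the edges. -/
def skeleton : Set M.Surface := {q | ∃ e, ∃ θ ∈ Icc (0 : ℝ) 1, q = M.pt e 0 θ}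

theorem exists_mem_openFace {q : M.Surface} (hq : q ∉ M.skeleton) :
    ∃ c F, q ∈ M.openFace c F := by
  obtain ⟨e, y, hy, θ, hθ, rfl⟩ := M.exists_pt_eq q
  have h0 : y ≠ 0 := by
    rintro rfl
    exact hq ⟨e, θ, hθ, rfl⟩
  obtain ⟨c, hc⟩ := exists_sgn_mul_pos h0
  exact ⟨c, M.faceOf c e, (M.pt_mem_openFace hy hθ).2 ⟨rfl, hc⟩⟩

theorem openFace_subset (c : Bool) (F : Face c) : M.openFace c F ⊆ M.skeletonᶜ := by
  rintro q hq ⟨e, θ, hθ, rfl⟩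
  rw [M.pt_mem_openFace (by simp) hθ] at hq
  simp at hq

theorem isConnected_openFace (c : Bool) (F : Face c) : IsConnected (M.openFace c F) := by
  obtain ⟨ch, h1, h2, -⟩ := M.exists_faceChart c F
  rw [← h1, ← ch.symm_image_target_eq_source, h2]
  have hb : IsConnected (ball (0 : ℂ) 1) :=
    (convex_ball _ _).isConnected ⟨0, by simp⟩
  refine hb.image _ ?_
  rw [← h2]
  exact ch.continuousOn_symm

theorem openFace_injective {c c' : Bool} {F : Face c} {F' : Face c'}
    (h : M.openFace c F = M.openFace c' F') : (⟨c, F⟩ : Σ c, Face c) = ⟨c', F'⟩ := by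
  obtain ⟨q, hq⟩ := (M.isConnected_openFace c F).nonempty
  exact M.eq_of_mem_openFace hq (h ▸ hq)

/-- The open faces are connected, open, pairwise disjoint, and cover the complement of the edges. -/
theorem connectedComponentIn_skeleton_compl {c : Bool} {F : Face c} {q : M.Surface}
    (hq : q ∈ M.openFace c F) : connectedComponentIn M.skeletonᶜ q = M.openFace c F := by
  apply Subset.antisymm
  · set W : Set M.Surface := ⋃ G ∈ {G : Σ c, Face c | G ≠ ⟨c, F⟩}, M.openFace G.1 G.2 with hW
    have hWo : IsOpen W := isOpen_biUnion fun G _ => M.isOpen_openFace G.1 G.2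
    have hdisj : Disjoint (M.openFace c F) W := by
      rw [Set.disjoint_left]
      intro z hz hzW
      obtain ⟨G, hG, hzG⟩ := mem_iUnion₂.1 hzW
      exact hG (M.eq_of_mem_openFace hzG hz)
    refine isPreconnected_connectedComponentIn.subset_left_of_subset_union
      (M.isOpen_openFace c F) hWo hdisj ?_ ⟨q, mem_connectedComponentIn (M.openFace_subset c F hq), hq⟩
    refine (connectedComponentIn_subset _ _).trans fun z hz => ?_
    obtain ⟨c', F', h⟩ := M.exists_mem_openFace hz
    by_cases hG : (⟨c', F'⟩ : Σ c, Face c) = ⟨c, F⟩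
    · left
      cases hG
      exact h
    · exact Or.inr (mem_iUnion₂.2 ⟨⟨c', F'⟩, hG, h⟩)
  · exact (M.isConnected_openFace c F).isPreconnected.subset_connectedComponentIn hq
      (M.openFace_subset c F)

theorem nonempty_openFace_homeomorph (c : Bool) (F : Face c) :
    Nonempty (M.openFace c F ≃ₜ ball (0 : ℂ) 1) := by
  obtain ⟨ch, h1, h2, -⟩ := M.exists_faceChart c F
  rw [← h1, ← h2]
  exact ⟨ch.toHomeomorphSourceTarget⟩

theorem frontier_openFace (c : Bool) (F : Face c) :
    frontier (M.openFace c F) = ⋃ j, (fun θ : unitInterval => M.pt (M.faceEdge c (F, j)) 0 θ) '' univ := by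
  have hedge : ∀ (j : Fin (len c)) (θ : unitInterval),
      M.faceMap c F (j, 1, θ) = M.pt (M.faceEdge c (F, j)) 0 θ := by
    intro j θ
    simp [faceMap]
  rw [(M.isOpen_openFace c F).frontier_eq]
  ext q
  constructor
  · rintro ⟨h1, h2⟩
    have hcl : IsClosed (range (M.faceMap c F)) :=
      (isCompact_range (M.continuous_faceMap c F)).isClosed
    have hsub : M.openFace c F ⊆ range (M.faceMap c F) := by
      rw [← M.faceMap_image_ball]
      exact image_subset_range _ _
    obtain ⟨⟨j, t, θ⟩, rfl⟩ := closure_minimal hsub hcl h1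
    rw [M.faceMap_mem_openFace] at h2
    obtain rfl : t = 1 := Subtype.ext (le_antisymm t.2.2 (not_lt.1 h2))
    exact mem_iUnion.2 ⟨j, θ, mem_univ _, (hedge j θ).symm⟩
  · intro hq
    obtain ⟨j, θ, -, rfl⟩ := mem_iUnion.1 hq
    simp only [← hedge]
    refine ⟨?_, by rw [M.faceMap_mem_openFace]; simp⟩
    have hg : Continuous fun t : unitInterval => M.faceMap c F (j, t, θ) :=
      (M.continuous_faceMap c F).comp (by fun_prop)
    -- A boundary point is the limit of the points of its radius.
    have h1 : (1 : unitInterval) ∈ closure (Iio 1) := by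
      rw [closure_Iio' ⟨0, by simp⟩]
      exact mem_Iic.2 le_rfl
    refine closure_mono ?_ (image_closure_subset_closure_image hg ⟨1, h1, rfl⟩)
    rintro _ ⟨t, ht, rfl⟩
    rw [M.faceMap_mem_openFace]
    exact ht

end CellData

/-! ### The multigraph drawn on the surface -/

/-- An identification of the edges of the gluing data with the edges of the multigraph `^λΓ`. -/
structure EdgeLabelling {V E : Type} {Face : Bool → Type} {len : Bool → ℕ} {N : ℕ}
    [∀ c, NeZero (len c)] [NeZero N] (M : CellData V E Face len N) (Γ : SimpleGraph V)
    (lam : ℕ) where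
  dart : E → MultiDart Γ lam
  fst_dart : ∀ e, (dart e).1.fst = M.src e
  snd_dart : ∀ e, (dart e).1.snd = M.tgt e
  existsUnique : ∀ d : MultiDart Γ lam, ∃! e, ((dart e).1.edge, (dart e).2) = (d.1.edge, d.2)

namespace EdgeLabelling

variable {V E : Type} {Face : Bool → Type} {len : Bool → ℕ} {N : ℕ} [∀ c, NeZero (len c)]
  [NeZero N] {M : CellData V E Face len N} {Γ : SimpleGraph V} {lam : ℕ}
  (L : EdgeLabelling M Γ lam)

/-- The edge that carries a directed edge of the multigraph. -/
noncomputable def edgeOf (d : MultiDart Γ lam) : E := (L.existsUnique d).choose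

theorem edgeOf_spec (d : MultiDart Γ lam) :
    ((L.dart (L.edgeOf d)).1.edge, (L.dart (L.edgeOf d)).2) = (d.1.edge, d.2) :=
  (L.existsUnique d).choose_spec.1

theorem edgeOf_eq {d : MultiDart Γ lam} {e : E}
    (h : ((L.dart e).1.edge, (L.dart e).2) = (d.1.edge, d.2)) : L.edgeOf d = e :=
  (L.existsUnique d).unique (L.edgeOf_spec d) h

@[simp] theorem edgeOf_dart (e : E) : L.edgeOf (L.dart e) = e := L.edgeOf_eq rfl

theorem edgeOf_symm (d : MultiDart Γ lam) : L.edgeOf (d.1.symm, d.2) = L.edgeOf d :=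
  L.edgeOf_eq (by rw [L.edgeOf_spec]; simp)

theorem dart_edgeOf (d : MultiDart Γ lam) :
    d = L.dart (L.edgeOf d) ∨ d = ((L.dart (L.edgeOf d)).1.symm, (L.dart (L.edgeOf d)).2) := by
  obtain ⟨h1, h2⟩ := Prod.mk.injEq _ _ _ _ ▸ L.edgeOf_spec d
  rcases SimpleGraph.dart_edge_eq_iff _ _ |>.1 h1.symm with h | h
  · exact Or.inl (Prod.ext h h2.symm)
  · exact Or.inr (Prod.ext h h2.symm)

open Classical in
/-- The embedding of the multigraph, before the gluing of its points and segments. -/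
noncomputable def preEmbed :
    (Σ _ : V, Unit) ⊕ (Σ _ : MultiDart Γ lam, unitInterval) → M.Surface
  | Sum.inl x => M.vertexPoint x.1
  | Sum.inr a => M.pt (L.edgeOf a.1) 0
      -- A directed edge opposite to the gluing edge that carries it is run through backwards.
      (if M.src (L.edgeOf a.1) = a.1.1.fst then (a.2 : ℝ) else 1 - a.2)

theorem src_ne_of_eq_symm {d : MultiDart Γ lam} {e : E}
    (h : d = ((L.dart e).1.symm, (L.dart e).2)) : M.src e ≠ d.1.fst ∧ M.tgt e = d.1.fst := by
  have : d.1.fst = M.tgt e := by rw [h, ← L.snd_dart e]; rfl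
  rw [this]
  exact ⟨M.src_ne_tgt e, rfl⟩

theorem src_eq_of_eq {d : MultiDart Γ lam} {e : E} (h : d = L.dart e) : M.src e = d.1.fst := by
  rw [h, L.fst_dart]

theorem preEmbed_eq_of_glue (a b) (h : Glue Γ lam a b) : L.preEmbed a = L.preEmbed b := by
  cases h with
  | source d =>
    refine M.pt_eq_vertexPoint ?_
    rcases L.dart_edgeOf d with h | h
    · have := L.src_eq_of_eq h
      exact Or.inl ⟨by simp [this], this⟩
    · obtain ⟨h1, h2⟩ := L.src_ne_of_eq_symm h
      exact Or.inr ⟨by simp [h1], h2⟩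
  | flip d r =>
    simp only [preEmbed]
    rw [L.edgeOf_symm]
    congr 1
    rcases L.dart_edgeOf d with h | h
    · have h1 := L.src_eq_of_eq h
      have h2 : M.src (L.edgeOf d) ≠ d.1.symm.fst := by
        rw [h1]
        exact d.1.fst_ne_snd
      rw [if_pos h1, if_neg h2, unitInterval.coe_symm_eq]
      ring
    · obtain ⟨h1, -⟩ := L.src_ne_of_eq_symm h
      have h2 : M.src (L.edgeOf d) = d.1.symm.fst := by
        rw [← L.fst_dart]
        conv_rhs => rw [h]
        rfl
      rw [if_neg h1, if_pos h2, unitInterval.coe_symm_eq]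

/-- The embedding of the multigraph in the surface. -/
noncomputable def embed : Realization Γ lam → M.Surface :=
  Quot.lift L.preEmbed L.preEmbed_eq_of_glue

theorem continuous_embed : Continuous L.embed := by
  refine continuous_quot_lift _ (continuous_sum_dom.2 ⟨?_, ?_⟩)
  · exact continuous_sigma fun x => (continuous_const : Continuous fun _ : Unit => M.vertexPoint x)
  · refine continuous_sigma fun d => ?_
    refine M.continuous_pt (L.edgeOf d) continuous_const ?_
    dsimp only
    split_ifs <;> fun_prop

/-- The point at a parameter of an edge. -/
def arc (e : E) (r : unitInterval) : Realization Γ lam := Quot.mk _ (Sum.inr ⟨L.dart e, r⟩)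

theorem embed_arc (e : E) (r : unitInterval) : L.embed (L.arc e r) = M.pt e 0 r := by
  change L.preEmbed (Sum.inr ⟨L.dart e, r⟩) = _
  simp only [preEmbed, L.edgeOf_dart, L.fst_dart, if_true]

theorem mk_dart_eq_arc (d : MultiDart Γ lam) (r : unitInterval) :
    ∃ r', (Quot.mk _ (Sum.inr ⟨d, r⟩) : Realization Γ lam) = L.arc (L.edgeOf d) r' ∧
      ((r' : ℝ) = r ∨ (r' : ℝ) = 1 - r) := by
  rcases L.dart_edgeOf d with h | h
  · exact ⟨r, by rw [arc, ← h], Or.inl rfl⟩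
  · refine ⟨unitInterval.symm r, ?_, Or.inr (unitInterval.coe_symm_eq r)⟩
    rw [Quot.sound (Glue.flip d r), arc]
    have : (d.1.symm, d.2) = L.dart (L.edgeOf d) := by
      conv_lhs => rw [h]
      simp
    rw [this]

/-- The point of a vertex in the topological multigraph. -/
def node (Γ : SimpleGraph V) (lam : ℕ) (x : V) : Realization Γ lam := Quot.mk _ (Sum.inl ⟨x, ()⟩)

theorem arc_eq_node {e : E} {r : unitInterval} {x : V} (h : M.IsEnd e r x) :
    L.arc e r = node Γ lam x := by
  rcases h with ⟨h, rfl⟩ | ⟨h, rfl⟩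
  · obtain rfl : r = 0 := Subtype.ext h
    rw [← L.fst_dart e]
    exact Quot.sound (Glue.source _)
  · obtain rfl : r = 1 := Subtype.ext h
    rw [← L.snd_dart e, arc, Quot.sound (Glue.flip _ _), unitInterval.symm_one]
    exact Quot.sound (Glue.source _)

theorem exists_arc_eq (q : Realization Γ lam) : ∃ e r, L.arc e r = q := by
  induction q using Quot.ind with
  | mk a =>
    rcases a with ⟨x, ⟨⟩⟩ | ⟨d, r⟩
    · exact ⟨M.outEdge (x, 0), 0, L.arc_eq_node (Or.inl ⟨rfl, M.src_outEdge x 0⟩)⟩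
    · obtain ⟨r', h, -⟩ := L.mk_dart_eq_arc d r
      exact ⟨_, r', h.symm⟩

/-- At `y = 0` the relation `Rel` identifies only common ends of edges, and these are already one
node of the multigraph. -/
theorem embed_injective : Function.Injective L.embed := by
  intro a b h
  obtain ⟨e, r, rfl⟩ := L.exists_arc_eq a
  obtain ⟨e', r', rfl⟩ := L.exists_arc_eq b
  rw [L.embed_arc, L.embed_arc, M.pt_eq_pt_iff (by simp) (by simp) r.2 r'.2] at h
  obtain ⟨-, ⟨rfl, h⟩ | ⟨-, x, hx, hx'⟩ | ⟨c, hc, -⟩⟩ := h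
  · rw [Subtype.ext h]
  · rw [L.arc_eq_node hx, L.arc_eq_node hx']
  · simp at hc

theorem range_embed : range L.embed = M.skeleton := by
  ext q
  constructor
  · rintro ⟨a, rfl⟩
    obtain ⟨e, r, rfl⟩ := L.exists_arc_eq a
    exact ⟨e, r, r.2, L.embed_arc e r⟩
  · rintro ⟨e, θ, hθ, rfl⟩
    exact ⟨L.arc e ⟨θ, hθ⟩, L.embed_arc e _⟩

theorem isFace_embed_iff (S : Set M.Surface) : IsFace L.embed S ↔ ∃ c F, S = M.openFace c F := by
  rw [IsFace, L.range_embed]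
  constructor
  · rintro ⟨q, hq, rfl⟩
    obtain ⟨c, F, h⟩ := M.exists_mem_openFace hq
    exact ⟨c, F, M.connectedComponentIn_skeleton_compl h⟩
  · rintro ⟨c, F, rfl⟩
    obtain ⟨q, hq⟩ := (M.isConnected_openFace c F).nonempty
    exact ⟨q, M.openFace_subset c F hq, (M.connectedComponentIn_skeleton_compl hq).symm⟩

theorem isCellular_embed : IsCellular L.embed := by
  intro S hS
  obtain ⟨c, F, rfl⟩ := (L.isFace_embed_iff S).1 hS
  exact M.nonempty_openFace_homeomorph c F

theorem connectedComponent_eq_of_lozenge {e : E} {y θ y' θ' : ℝ} (hy : y ∈ Icc (-1 : ℝ) 1)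
    (hθ : θ ∈ Icc (0 : ℝ) 1) (hy' : y' ∈ Icc (-1 : ℝ) 1) (hθ' : θ' ∈ Icc (0 : ℝ) 1) :
    connectedComponent (M.pt e y θ) = connectedComponent (M.pt e y' θ') := by
  have h : IsPreconnected (range (M.lozenge e)) := by
    have : PreconnectedSpace (Icc (-1 : ℝ) 1) := Subtype.preconnectedSpace isPreconnected_Icc
    have : PreconnectedSpace (Icc (0 : ℝ) 1) := Subtype.preconnectedSpace isPreconnected_Icc
    exact isPreconnected_range (M.continuous_lozenge e)
  exact connectedComponent_eq (h.subset_connectedComponent ⟨(⟨y, hy⟩, ⟨θ, hθ⟩), rfl⟩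
    ⟨(⟨y', hy'⟩, ⟨θ', hθ'⟩), rfl⟩)

/-- Each lozenge is connected and contains both ends of its edge, so connectedness passes from the
graph to the surface. -/
theorem connectedSpace (L : EdgeLabelling M Γ lam) (hΓ : Γ.Connected) (hlam : 0 < lam) : ConnectedSpace M.Surface := by
  have hadj : ∀ x x', Γ.Adj x x' →
      connectedComponent (M.vertexPoint x) = connectedComponent (M.vertexPoint x') := by
    intro x x' h
    have key : ∀ e, connectedComponent (M.vertexPoint (M.src e)) =
        connectedComponent (M.vertexPoint (M.tgt e)) := by
      intro e
      rw [← M.pt_eq_vertexPoint (e := e) (θ := 0) (Or.inl ⟨rfl, rfl⟩),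
        ← M.pt_eq_vertexPoint (e := e) (θ := 1) (Or.inr ⟨rfl, rfl⟩)]
      exact connectedComponent_eq_of_lozenge (by simp) (by simp) (by simp) (by simp)
    have hk := key (L.edgeOf (⟨(x, x'), h⟩, ⟨0, hlam⟩))
    rw [← L.fst_dart, ← L.snd_dart] at hk
    rcases L.dart_edgeOf (⟨(x, x'), h⟩, ⟨0, hlam⟩) with hd | hd
    · rw [← hd] at hk
      exact hk
    · have h1 : x = (L.dart (L.edgeOf (⟨(x, x'), h⟩, ⟨0, hlam⟩))).1.snd :=
        congrArg (fun d => d.1.fst) hd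
      have h2 : x' = (L.dart (L.edgeOf (⟨(x, x'), h⟩, ⟨0, hlam⟩))).1.fst :=
        congrArg (fun d => d.1.snd) hd
      rw [← h1, ← h2] at hk
      exact hk.symm
  have hall : ∀ x x', connectedComponent (M.vertexPoint x) = connectedComponent (M.vertexPoint x') := by
    intro x x'
    obtain ⟨p⟩ := hΓ.preconnected x x'
    induction p with
    | nil => rfl
    | cons h _ ih => exact (hadj _ _ h).trans ih
  obtain ⟨x₀⟩ := hΓ.nonempty
  rw [connectedSpace_iff_connectedComponent]
  refine ⟨M.vertexPoint x₀, eq_univ_of_forall fun q => ?_⟩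
  obtain ⟨e, y, hy, θ, hθ, rfl⟩ := M.exists_pt_eq q
  rw [hall x₀ (M.src e), ← M.pt_eq_vertexPoint (e := e) (θ := 0) (Or.inl ⟨rfl, rfl⟩),
    connectedComponent_eq_of_lozenge (y' := y) (θ' := θ) (by simp) (by simp) hy hθ]
  exact mem_connectedComponent

/-- The cycle of the multigraph that bounds a face. -/
def faceCycle {c : Bool} (hc : 2 ≤ len c) (F : Face c) : MultiCycle Γ lam (len c) where
  two_le := hc
  dart j := L.dart (M.faceEdge c (F, j))
  closed j := by
    rw [L.snd_dart, L.fst_dart, ← M.src_next c, ← M.faceEdge_succ, finRotate_apply]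
  vertex_injective := by
    simp only [L.fst_dart]
    exact M.src_faceEdge_injective c F
  edge_injective j j' h := by
    have := (L.existsUnique _).unique rfl h.symm
    exact congrArg Prod.snd ((M.faceEdge c).injective this)

/-- Each undirected edge is carried by a single gluing edge, which occurs at a single position among
the faces of a given colour. -/
theorem isCycleDecomposition
    {D : ∀ c, Face c → MultiCycle Γ lam (len c)}
    (hD : ∀ c F j, (D c F).dart j = L.dart (M.faceEdge c (F, j))) (c : Bool) :
    IsCycleDecomposition (D c) := by
  intro e he i
  induction e using Sym2.ind with
  | _ x y =>
    obtain ⟨f, hf, huniq⟩ := L.existsUnique (⟨(x, y), he⟩, i)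
    refine ⟨(M.faceEdge c).symm f, ?_, ?_⟩
    · simp only [hD]
      rw [Prod.mk.eta, Equiv.apply_symm_apply]
      exact hf
    · rintro ⟨F, j⟩ h
      simp only [hD] at h
      rw [← huniq _ h, Equiv.symm_apply_apply]

theorem frontier_openFace_eq
    {D : ∀ c, Face c → MultiCycle Γ lam (len c)}
    (hD : ∀ c F j, (D c F).dart j = L.dart (M.faceEdge c (F, j)))
    (c : Bool) (F : Face c) :
    frontier (M.openFace c F) = L.embed '' (D c F).carrier := by
  rw [M.frontier_openFace, MultiCycle.carrier, image_iUnion]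
  congr 1
  funext j
  rw [image_univ, hD, edgeArc]
  refine Eq.trans ?_ (range_comp L.embed (L.arc (M.faceEdge c (F, j))))
  congr 1
  funext r
  exact (L.embed_arc _ r).symm

theorem faceOf_edgeOf_eq {c : Bool} {F : Face c} {d : MultiDart Γ lam}
    (h : L.embed '' edgeArc d ⊆ frontier (M.openFace c F)) : M.faceOf c (L.edgeOf d) = F := by
  -- The midpoint is fixed by reversal of the edge and is not an end, so it lies on no other edge.
  let r : unitInterval := ⟨1 / 2, by norm_num, by norm_num⟩
  obtain ⟨r', hr', hr⟩ := L.mk_dart_eq_arc d r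
  have hr2 : (r' : ℝ) = 1 / 2 := by
    rcases hr with hr | hr
    · rw [hr]
    · rw [hr]
      norm_num [r]
  have hmem : L.embed (Quot.mk _ (Sum.inr ⟨d, r⟩)) ∈ frontier (M.openFace c F) :=
    h ⟨_, ⟨r, rfl⟩, rfl⟩
  rw [hr', L.embed_arc, M.frontier_openFace] at hmem
  obtain ⟨j, θ, -, hj⟩ := mem_iUnion.1 hmem
  simp only at hj
  rw [M.pt_eq_pt_iff (by simp) (by simp) θ.2 r'.2] at hj
  obtain ⟨-, ⟨he, -⟩ | ⟨-, x, -, hx⟩ | ⟨c', hc', -⟩⟩ := hj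
  · rw [← he, M.faceOf_faceEdge]
  · rcases hx with ⟨hx, -⟩ | ⟨hx, -⟩ <;> rw [hr2] at hx <;> norm_num at hx
  · simp at hc'

-- The colouring is proper because an edge has exactly one face of each colour: two faces of one
-- colour that share an edge coincide.
open Classical in
theorem isBiembedding
    {D : ∀ c, Face c → MultiCycle Γ lam (len c)}
    (hD : ∀ c F j, (D c F).dart j = L.dart (M.faceEdge c (F, j))) :
    IsBiembedding L.embed (D true) (D false) := by
  set color : Set M.Surface → Bool := fun S => decide (∃ F, S = M.openFace true F) with hcolor
  have hcol : ∀ c F, color (M.openFace c F) = c := by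
    intro c F
    cases c
    · simp only [hcolor, decide_eq_false_iff_not]
      rintro ⟨F', h⟩
      have := congrArg Sigma.fst (M.openFace_injective h)
      simp at this
    · simp only [hcolor, decide_eq_true_eq]
      exact ⟨F, rfl⟩
  have hbij : ∀ c, ∃ f : Face c → Set M.Surface,
      BijOn f univ {S | IsFace L.embed S ∧ color S = c} ∧
        ∀ F, frontier (f F) = L.embed '' (D c F).carrier := by
    intro c
    refine ⟨M.openFace c, ⟨?_, ?_, ?_⟩, fun F => L.frontier_openFace_eq hD c F⟩
    · exact fun F _ => ⟨(L.isFace_embed_iff _).2 ⟨c, F, rfl⟩, hcol c F⟩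
    · intro F _ F' _ h
      have := M.openFace_injective h
      simpa using this
    · rintro S ⟨hS, hc⟩
      obtain ⟨c', F, rfl⟩ := (L.isFace_embed_iff S).1 hS
      rw [hcol] at hc
      subst hc
      exact ⟨F, mem_univ _, rfl⟩
  refine ⟨L.isCycleDecomposition hD true, L.isCycleDecomposition hD false,
    ⟨L.continuous_embed, L.embed_injective⟩, color, ?_, hbij true, hbij false⟩
  intro S S' hS hS' hne d h h'
  obtain ⟨c, F, rfl⟩ := (L.isFace_embed_iff S).1 hS
  obtain ⟨c', F', rfl⟩ := (L.isFace_embed_iff S').1 hS'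
  rw [hcol, hcol]
  rintro rfl
  apply hne
  rw [← L.faceOf_edgeOf_eq h, ← L.faceOf_edgeOf_eq h']

end EdgeLabelling

/-! ### Partial sums and the edges of the cycles of an ordering -/

namespace LineOrdering

variable {B ι G : Type} {line : B → ι} [AddCommGroup G] (ω : LineOrdering line) (a : B → G)

/-- The number of cells of a line. -/
def HasLength (line : B → ι) (ℓ : ℕ) : Prop :=
  ∀ i, ∃ s : Finset B, (s : Set B) = {b | line b = i} ∧ s.card = ℓ

theorem line_perm (b : B) : line (ω.perm b) = line b :=
  (ω.isCycleOn (line b)).1.mapsTo (show b ∈ {b' | line b' = line b} from rfl)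

theorem line_perm_pow (n : ℕ) (b : B) : line ((ω.perm ^ n) b) = line b := by
  induction n with
  | zero => rfl
  | succ n ih => rw [pow_succ', Equiv.Perm.mul_apply, ω.line_perm, ih]

theorem partialSum_succ (i : ι) (j : ℕ) :
    ω.partialSum a i (j + 1) = ω.partialSum a i j + a ((ω.perm ^ j) (ω.start i)) :=
  Finset.sum_range_succ _ _

theorem perm_pow_length {ℓ : ℕ} (hℓ : HasLength line ℓ) (i : ι) :
    (ω.perm ^ ℓ) (ω.start i) = ω.start i := by
  obtain ⟨s, hs, rfl⟩ := hℓ i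
  have hc := ω.isCycleOn i
  rw [← hs] at hc
  refine hc.pow_card_apply ?_
  rw [← Finset.mem_coe, hs]
  exact ω.line_start i

theorem exists_perm_pow_eq {ℓ : ℕ} (hℓ : HasLength line ℓ) (b : B) :
    ∃ j < ℓ, (ω.perm ^ j) (ω.start (line b)) = b := by
  obtain ⟨s, hs, rfl⟩ := hℓ (line b)
  have hc := ω.isCycleOn (line b)
  rw [← hs] at hc
  refine hc.exists_pow_eq ?_ ?_ <;> rw [← Finset.mem_coe, hs]
  · exact ω.line_start _
  · rfl

theorem perm_pow_eq_iff {ℓ : ℕ} (hℓ : HasLength line ℓ) (i : ι) {j j' : ℕ} :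
    (ω.perm ^ j) (ω.start i) = (ω.perm ^ j') (ω.start i) ↔ j ≡ j' [MOD ℓ] := by
  obtain ⟨s, hs, rfl⟩ := hℓ i
  have hc := ω.isCycleOn i
  rw [← hs] at hc
  refine hc.pow_apply_eq_pow_apply ?_
  rw [← Finset.mem_coe, hs]
  exact ω.line_start i

theorem partialSum_length {ℓ : ℕ} (hℓ : HasLength line ℓ) {i : ι} {s : Finset B}
    (hs : (s : Set B) = {b | line b = i}) (hsum : ∑ b ∈ s, a b = 0) : ω.partialSum a i ℓ = 0 := by
  rw [partialSum, ← hsum]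
  have hmem : ∀ b, b ∈ s ↔ line b = i := fun b => by rw [← Finset.mem_coe, hs]; rfl
  refine Finset.sum_nbij (fun l => (ω.perm ^ l) (ω.start i)) ?_ ?_ ?_ fun _ _ => rfl
  · intro l _
    rw [hmem, ω.line_perm_pow, ω.line_start]
  · intro l hl l' hl' h
    rw [Finset.coe_range, mem_Iio] at hl hl'
    have := (ω.perm_pow_eq_iff hℓ i).1 h
    exact Nat.ModEq.eq_of_lt_of_lt this hl hl'
  · intro b hb
    have hb' := (hmem b).1 hb
    obtain ⟨j, hj, h⟩ := ω.exists_perm_pow_eq hℓ b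
    rw [hb'] at h
    exact ⟨j, by simpa using hj, h⟩

/-- The partial sums of the reverse of a line that sums to zero. -/
theorem inv_partialSum_add {ℓ : ℕ} (hℓ : HasLength line ℓ) {i : ι}
    (h0 : ω.partialSum a i ℓ = 0) {j : ℕ} (hj : j ≤ ℓ) :
    ω.inv.partialSum a i j + ω.partialSum a i (ℓ - j) = 0 := by
  induction j with
  | zero => simpa [partialSum] using h0
  | succ j ih =>
    have h1 : ℓ - j = (ℓ - (j + 1)) + 1 := by omega
    -- The reverse starts at the last cell, so going back `j + 1` cells from the start is going
    -- forward `ℓ - (j + 1)`.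
    have h2 : (ω.inv.perm ^ j) (ω.inv.start i) = (ω.perm ^ (ℓ - (j + 1))) (ω.start i) := by
      change ((ω.perm⁻¹) ^ j) (ω.perm⁻¹ (ω.start i)) = _
      rw [← Equiv.Perm.mul_apply, ← pow_succ, inv_pow, Equiv.Perm.inv_eq_iff_eq,
        ← Equiv.Perm.mul_apply, ← pow_add, Nat.add_sub_cancel' hj, ω.perm_pow_length hℓ]
    have h3 := ih (by omega)
    rw [h1, partialSum_succ] at h3
    rw [partialSum_succ, h2, ← h3]
    abel

/-- Reversal replaces `s_j` by `-s_{ℓ-j}`, which preserves distinctness. -/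
theorem IsSimple.inv {ω : LineOrdering line} {a : B → G} {ℓ : ℕ} (hℓ : HasLength line ℓ)
    (h0 : ∀ i, ω.partialSum a i ℓ = 0) (h : ω.IsSimple a ℓ) : ω.inv.IsSimple a ℓ := by
  intro i j hj j' hj' hjj
  have key : ∀ j ∈ Icc 1 ℓ, ∃ l ∈ Icc 1 ℓ, ω.partialSum a i l = -ω.inv.partialSum a i j ∧
      (l = ℓ - j ∨ (l = ℓ ∧ j = ℓ)) := by
    intro j hj
    have h1 := ω.inv_partialSum_add a hℓ (h0 i) hj.2
    have h2 := eq_neg_of_add_eq_zero_right h1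
    -- For `j = ℓ` the index `ℓ - j = 0` falls outside `[1, ℓ]`; since `s_0 = s_ℓ = 0`, the index
    -- `ℓ` replaces it.
    rcases hj.2.eq_or_lt with h3 | h3
    · refine ⟨ℓ, ⟨hj.1.trans hj.2, le_rfl⟩, ?_, Or.inr ⟨rfl, h3⟩⟩
      rw [← h2, h0, h3, Nat.sub_self]
      simp [partialSum]
    · exact ⟨ℓ - j, ⟨by omega, by omega⟩, h2, Or.inl rfl⟩
  obtain ⟨l, hl, h1, h2⟩ := key j hj
  obtain ⟨l', hl', h1', h2'⟩ := key j' hj'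
  have := h i hl hl' (by rw [h1, h1', hjj])
  have := hj.1
  have := hj.2
  have := hj'.1
  have := hj'.2
  omega

/-- From an edge of `D_ω` to the next edge in its cycle; the edge `(b, x)` goes from `x` to
`x + a b`. -/
def shift : Equiv.Perm (B × G) where
  toFun e := (ω.perm e.1, e.2 + a e.1)
  invFun e := (ω.perm⁻¹ e.1, e.2 - a (ω.perm⁻¹ e.1))
  left_inv e := by simp
  right_inv e := by simp

/-- The edges of the cycles of `D_ω`. -/
def cycleEdge (p : (ι × G) × ℕ) : B × G :=
  -- The edge at position `j`, counted from `0`, leaves `s_{j+1} + g`; it therefore carries the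
  -- entry after the first `j + 1`.
  ((ω.perm ^ (p.2 + 1)) (ω.start p.1.1), ω.partialSum a p.1.1 (p.2 + 1) + p.1.2)

theorem cycleEdge_succ (q : ι × G) (j : ℕ) :
    ω.cycleEdge a (q, j + 1) = ω.shift a (ω.cycleEdge a (q, j)) := by
  simp only [cycleEdge, shift, Equiv.coe_fn_mk]
  rw [partialSum_succ _ _ _ (j + 1), pow_succ' _ (j + 1), Equiv.Perm.mul_apply]
  refine Prod.ext rfl ?_
  simp only
  abel

theorem cycleEdge_length {ℓ : ℕ} (hℓ : HasLength line ℓ) (h0 : ∀ i, ω.partialSum a i ℓ = 0)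
    (q : ι × G) : ω.cycleEdge a (q, ℓ) = ω.cycleEdge a (q, 0) := by
  simp only [cycleEdge]
  rw [partialSum_succ, h0, ω.perm_pow_length hℓ, pow_succ', Equiv.Perm.mul_apply,
    ω.perm_pow_length hℓ]
  simp [partialSum]

/-- For an edge `(b, x)`, the cell `b` determines the line and the position in it, and then `x`
determines the translate. -/
theorem cycleEdge_bijective {ℓ : ℕ} (hℓ : HasLength line ℓ) :
    Function.Bijective fun p : (ι × G) × Fin ℓ => ω.cycleEdge a (p.1, p.2) := by
  constructor
  · rintro ⟨⟨i, g⟩, j⟩ ⟨⟨i', g'⟩, j'⟩ h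
    obtain ⟨h1, h2⟩ := Prod.mk.inj h
    have hi := congrArg line h1
    simp only [ω.line_perm_pow, ω.line_start] at hi
    subst hi
    have hj := (ω.perm_pow_eq_iff hℓ i).1 h1
    have hj' : (j : ℕ) = j' := (Nat.ModEq.add_right_cancel' 1 hj).eq_of_lt_of_lt j.2 j'.2
    obtain rfl := Fin.ext hj'
    simp only [add_right_inj] at h2
    rw [h2]
  · rintro ⟨b, x⟩
    obtain ⟨j, hj, h⟩ := ω.exists_perm_pow_eq hℓ (ω.perm⁻¹ b)
    have hl : line (ω.perm⁻¹ b) = line b := by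
      rw [← ω.line_perm (ω.perm⁻¹ b)]
      simp
    rw [hl] at h
    refine ⟨((line b, x - ω.partialSum a (line b) (j + 1)), ⟨j, hj⟩), ?_⟩
    simp only [cycleEdge]
    rw [pow_succ', Equiv.Perm.mul_apply, h]
    simp

/-- The edges of the cycles of `D_ω`, each of which occurs once. -/
noncomputable def cycleEdgeEquiv {ℓ : ℕ} (hℓ : HasLength line ℓ) : (ι × G) × Fin ℓ ≃ B × G :=
  Equiv.ofBijective _ (ω.cycleEdge_bijective a hℓ)

theorem cycleEdgeEquiv_apply {ℓ : ℕ} (hℓ : HasLength line ℓ) (q : ι × G) (j : Fin ℓ) :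
    ω.cycleEdgeEquiv a hℓ (q, j) = ω.cycleEdge a (q, j) := rfl

/-- At the last position the successor wraps around; the cycle closes there because the line sums to
zero. -/
theorem cycleEdgeEquiv_succ {ℓ : ℕ} [NeZero ℓ] (hℓ : HasLength line ℓ)
    (h0 : ∀ i, ω.partialSum a i ℓ = 0) (q : ι × G) (j : Fin ℓ) :
    ω.cycleEdgeEquiv a hℓ (q, j + 1) = ω.shift a (ω.cycleEdgeEquiv a hℓ (q, j)) := by
  rw [cycleEdgeEquiv_apply, cycleEdgeEquiv_apply, ← cycleEdge_succ]
  have h : ((j + 1 : Fin ℓ) : ℕ) = ((j : ℕ) + 1) % ℓ := by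
    rw [Fin.val_add]; simp
  rw [h]
  rcases (Nat.succ_le_of_lt j.2).eq_or_lt with h1 | h1
  · have h2 : (j : ℕ) + 1 = ℓ := h1
    rw [h2, Nat.mod_self, ω.cycleEdge_length a hℓ h0]
  · rw [Nat.mod_eq_of_lt h1]

theorem IsSimple.cycleEdgeEquiv_snd_injective {ω : LineOrdering line} {a : B → G} {ℓ : ℕ}
    (h : ω.IsSimple a ℓ) (hℓ : HasLength line ℓ) (q : ι × G) :
    Function.Injective fun j => (ω.cycleEdgeEquiv a hℓ (q, j)).2 := by
  intro j j' hj
  have h1 : (j : ℕ) + 1 = j' + 1 :=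
    h q.1 ⟨by omega, j.2⟩ ⟨by omega, j'.2⟩ (add_right_cancel hj)
  exact Fin.ext (by omega)

/-- In a line with a single cell, the entry would equal the sum of the line, which is zero. -/
theorem two_le_length {ℓ : ℕ} (hℓ : HasLength line ℓ) {i : ι} (h0 : ω.partialSum a i ℓ = 0)
    (hne : ∀ b, a b ≠ 0) : 2 ≤ ℓ := by
  have h1 : ℓ ≠ 0 := by
    obtain ⟨s, hs, rfl⟩ := hℓ i
    have : ω.start i ∈ s := by
      rw [← Finset.mem_coe, hs]
      exact ω.line_start i
    exact (Finset.card_pos.2 ⟨_, this⟩).ne'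
  have h2 : ℓ ≠ 1 := by
    rintro rfl
    apply hne (ω.start i)
    simpa [partialSum] using h0
  omega

end LineOrdering

/-- A map all of whose fibres have `t` elements is a projection. -/
theorem exists_equiv_prod_fin {E X : Type} {t : ℕ} (ht : t ≠ 0) (f : E → X)
    (hf : ∀ x, Nat.card {e // f e = x} = t) : ∃ φ : E ≃ X × Fin t, ∀ e, (φ e).1 = f e := by
  have h : ∀ x, Nonempty ({e // f e = x} ≃ Fin t) := by
    intro x
    -- `Nat.card` is `0` on infinite types, which `t ≠ 0` rules out.
    have : Finite {e // f e = x} := Nat.finite_of_card_ne_zero (by rw [hf]; exact ht)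
    exact ⟨(Finite.equivFin _).trans (finCongr (hf x))⟩
  let g := fun x => (h x).some
  exact ⟨(Equiv.sigmaFiberEquiv f).symm.trans ((Equiv.sigmaCongrRight g).trans
    (Equiv.sigmaEquivProd X (Fin t))), fun e => rfl⟩

/-! ### The complete multipartite graph of cosets -/

section CosetGraph

variable {G : Type} [AddCommGroup G] (J : AddSubgroup G)

theorem card_fiber_mk (q : G ⧸ J) : Nat.card {x : G // (x : G ⧸ J) = q} = Nat.card J := by
  induction q using QuotientAddGroup.induction_on with
  | H y =>
    refine Nat.card_congr
      { toFun := fun x => ⟨-y + x.1, QuotientAddGroup.eq.1 x.2.symm⟩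
        invFun := fun z => ⟨y + z.1, (QuotientAddGroup.eq.2 (by simp)).symm⟩
        left_inv := fun x => by simp
        right_inv := fun z => by simp }

theorem nonempty_cosetGraph_iso [Finite G] {r t : ℕ} (ht : Nat.card J = t)
    (hr : Nat.card G = r * t) :
    Nonempty (cosetGraph J ≃g SimpleGraph.completeEquipartiteGraph r t) := by
  have ht0 : t ≠ 0 := by rw [← ht]; exact Nat.card_pos.ne'
  obtain ⟨φ, hφ⟩ := exists_equiv_prod_fin ht0 (fun x : G => (x : G ⧸ J))
    (fun q => by rw [card_fiber_mk, ht])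
  have hq : Nat.card (G ⧸ J) = r := by
    have := AddSubgroup.card_eq_card_quotient_mul_card_addSubgroup J
    rw [hr, ht] at this
    exact (Nat.eq_of_mul_eq_mul_right (Nat.pos_of_ne_zero ht0) this).symm
  let g : (G ⧸ J) ≃ Fin r := (Finite.equivFin _).trans (finCongr hq)
  refine ⟨⟨φ.trans (g.prodCongr (Equiv.refl _)), ?_⟩⟩
  intro x y
  rw [SimpleGraph.completeEquipartiteGraph_adj]
  simp only [Equiv.trans_apply, Equiv.prodCongr_apply, Prod.map_fst, hφ, cosetGraph, ne_eq,
    g.injective.eq_iff]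
  rw [QuotientAddGroup.eq, ← J.neg_mem_iff]
  simp [sub_eq_add_neg, add_comm]

/-- Two vertices of the same coset have the common neighbour `x + a`; all others are adjacent. -/
theorem connected_cosetGraph {a : G} (ha : a ∉ J) : (cosetGraph J).Connected := by
  have : Nonempty G := ⟨a⟩
  refine ⟨fun x y => ?_⟩
  by_cases h : x - y ∈ J
  · have h1 : (cosetGraph J).Adj x (x + a) := by
      change x - (x + a) ∉ J
      simpa using ha
    have h2 : (cosetGraph J).Adj (x + a) y := by
      change x + a - y ∉ J
      intro h3
      apply ha
      have := J.sub_mem h3 h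
      simpa using this
    exact h1.reachable.trans h2.reachable
  · exact SimpleGraph.Adj.reachable (show (cosetGraph J).Adj x y from h)

end CosetGraph

theorem hasLength_of_card {B ι : Type} [Fintype B] [DecidableEq ι] {line : B → ι} {ℓ : ℕ}
    (h : ∀ i, Fintype.card {b // line b = i} = ℓ) : LineOrdering.HasLength line ℓ := by
  intro i
  refine ⟨Finset.univ.filter fun b => line b = i, by ext; simp, ?_⟩
  rw [← h i, Fintype.card_subtype]

theorem partialSum_eq_zero {B ι G : Type} [Fintype B] [DecidableEq ι] [AddCommGroup G]
    {line : B → ι} (ω : LineOrdering line) {a : B → G} {ℓ : ℕ}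
    (h : ∀ i, Fintype.card {b // line b = i} = ℓ) (hsum : ∀ i, ∑ b : {b // line b = i}, a b.1 = 0)
    (i : ι) : ω.partialSum a i ℓ = 0 := by
  refine ω.partialSum_length a (hasLength_of_card h) (i := i)
    (s := Finset.univ.filter fun b => line b = i) (by ext; simp) ?_
  rw [← hsum i]
  exact Finset.sum_subtype _ (by simp) a

/-! ### Counting the entries of a Heffter array -/

namespace IsHeffterArray

variable {m n v lam t s k : ℕ} {J : AddSubgroup (ZMod v)} {A : PFArray m n (ZMod v)}

theorem card_skel (hA : IsHeffterArray lam t s k J A) : Fintype.card A.Skel = n * k := by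
  rw [Fintype.card_congr (Equiv.sigmaFiberEquiv A.col).symm, Fintype.card_sigma]
  simp [hA.col_filled]

theorem pos (hA : IsHeffterArray lam t s k J A) (b : A.Skel) : 0 < n * k ∧ 0 < lam ∧ 0 < t ∧ 0 < v := by
  have h1 : 0 < n * k := by
    rw [← hA.card_skel]
    exact Fintype.card_pos_iff.2 ⟨b⟩
  have h2 : 0 < 2 * n * k := by
    rw [mul_assoc]
    omega
  have h3 : 0 < lam := Nat.pos_of_dvd_of_pos hA.lam_dvd h2
  have h4 : 0 < 2 * n * k / lam := Nat.div_pos (Nat.le_of_dvd h2 hA.lam_dvd) h3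
  have h5 : 0 < t := Nat.pos_of_dvd_of_pos hA.t_dvd h4
  have := hA.v_eq
  exact ⟨h1, h3, h5, by omega⟩

/-- The multiset `{±x}` has `2nk` elements. The `v - t = 2nk / λ` elements outside `J` account for
`λ` each, hence for all of them, and none is left for `J`. -/
theorem entry_notMem [NeZero v] (hA : IsHeffterArray lam t s k J A) (b : A.Skel) :
    A.entry b ∉ J := by
  classical
  intro hb
  set μ : Multiset (ZMod v) := (Finset.univ : Finset A.Skel).val.map A.entry +
    (Finset.univ : Finset A.Skel).val.map (fun b => -A.entry b) with hμ
  have hcard : Multiset.card μ = 2 * n * k := by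
    simp only [hμ, Multiset.card_add, Multiset.card_map, Finset.card_val, Finset.card_univ,
      hA.card_skel]
    ring
  have hsum := Multiset.sum_count_eq_card (s := Finset.univ) (m := μ) (fun _ _ => Finset.mem_univ _)
  rw [← Finset.sum_filter_add_sum_filter_not _ (fun x => x ∈ J)] at hsum
  have hout : ∑ x ∈ Finset.univ.filter (fun x => ¬ x ∈ J), μ.count x = 2 * n * k := by
    rw [Finset.sum_congr rfl (fun x hx => hA.count_eq x (Finset.mem_filter.1 hx).2),
      Finset.sum_const, smul_eq_mul]
    have h1 : (Finset.univ.filter (fun x => x ∈ J)).card = t := by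
      rw [← hA.card_J, Nat.card_eq_fintype_card, ← Fintype.card_subtype]
    have h2 := Finset.card_filter_add_card_filter_not (s := (Finset.univ : Finset (ZMod v)))
      (fun x => x ∈ J)
    rw [h1, Finset.card_univ, ZMod.card] at h2
    have h3 := hA.v_eq
    have h4 : (Finset.univ.filter (fun x => ¬ x ∈ J)).card = 2 * n * k / lam := by omega
    rw [h4, Nat.div_mul_cancel hA.lam_dvd]
  rw [hout, hcard] at hsum
  have hin : ∑ x ∈ Finset.univ.filter (fun x => x ∈ J), μ.count x = 0 := by omega
  have h0 := Finset.sum_eq_zero_iff.1 hin (A.entry b) (by simpa using hb)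
  have hmem : A.entry b ∈ μ := by
    rw [hμ, Multiset.mem_add]
    exact Or.inl (Multiset.mem_map_of_mem _ (Finset.mem_univ b))
  exact absurd hmem (Multiset.count_eq_zero.1 h0)

/-- Each edge `{x, y}` of the multipartite graph is covered by `λ` edges `(b, z)`. -/
theorem card_fiber [NeZero v] (hA : IsHeffterArray lam t s k J A) {x y : ZMod v}
    (hxy : x - y ∉ J) :
    Nat.card {e : A.Skel × ZMod v // s(e.2, e.2 + A.entry e.1) = s(x, y)} = lam := by
  classical
  have hne : x ≠ y := by
    rintro rfl
    exact hxy (by simp)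
  have hyx : y - x ∉ J := by
    intro h
    exact hxy (by simpa using J.neg_mem h)
  have hcount := hA.count_eq (y - x) hyx
  rw [Multiset.count_add, Multiset.count_map, Multiset.count_map] at hcount
  -- The occurrences of `y - x` in `A` are the edges leaving `x` for `y`; those in `-A`, counted
  -- next, are the edges leaving `y` for `x`. As `x ≠ y`, no edge is counted twice, even if `y - x`
  -- is its own negative.
  have h1 : (Multiset.filter (fun b => y - x = A.entry b)
      (Finset.univ : Finset A.Skel).val).card = Nat.card {b : A.Skel // x + A.entry b = y} := by
    rw [Nat.card_eq_fintype_card, Fintype.card_subtype]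
    change (Finset.univ.filter fun b => y - x = A.entry b).card = _
    congr 1
    ext b
    simp only [Finset.mem_filter, Finset.mem_univ, true_and]
    rw [sub_eq_iff_eq_add', eq_comm]
  have h2 : (Multiset.filter (fun b => y - x = -A.entry b)
      (Finset.univ : Finset A.Skel).val).card = Nat.card {b : A.Skel // y + A.entry b = x} := by
    rw [Nat.card_eq_fintype_card, Fintype.card_subtype]
    change (Finset.univ.filter fun b => y - x = -A.entry b).card = _
    congr 1
    ext b
    simp only [Finset.mem_filter, Finset.mem_univ, true_and]
    constructor <;> intro h
    · have := congrArg (fun z => z + x + A.entry b) h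
      simpa using this
    · rw [← h]; abel
  rw [h1, h2, ← Nat.card_sum] at hcount
  rw [← hcount]
  have hto : ∀ e : {e : A.Skel × ZMod v // s(e.2, e.2 + A.entry e.1) = s(x, y)},
      (e.1.2 = x ∧ e.1.2 + A.entry e.1.1 = y) ∨ (e.1.2 = y ∧ e.1.2 + A.entry e.1.1 = x) :=
    fun e => by simpa using e.2
  refine (Nat.card_congr (Equiv.ofBijective (fun b : {b : A.Skel // x + A.entry b = y} ⊕
    {b : A.Skel // y + A.entry b = x} => (Sum.elim (fun b => ⟨(b.1, x), by rw [b.2]⟩)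
      (fun b => ⟨(b.1, y), by rw [b.2, Sym2.eq_swap]⟩) b :
        {e : A.Skel × ZMod v // s(e.2, e.2 + A.entry e.1) = s(x, y)})) ⟨?_, ?_⟩)).symm
  · rintro (⟨b, hb⟩ | ⟨b, hb⟩) (⟨b', hb'⟩ | ⟨b', hb'⟩) h <;>
      simp only [Sum.elim_inl, Sum.elim_inr, Subtype.mk.injEq, Prod.mk.injEq] at h
    · simp [h.1]
    · exact absurd h.2 hne
    · exact absurd h.2 hne.symm
    · simp [h.1]
  · intro e
    rcases hto e with ⟨h1, h2⟩ | ⟨h1, h2⟩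
    · exact ⟨Sum.inl ⟨e.1.1, by rwa [h1] at h2⟩, Subtype.ext (Prod.ext rfl h1.symm)⟩
    · exact ⟨Sum.inr ⟨e.1.1, by rwa [h1] at h2⟩, Subtype.ext (Prod.ext rfl h1.symm)⟩

theorem card_zmod (hA : IsHeffterArray lam t s k J A) : v = (2 * n * k / (lam * t) + 1) * t := by
  rw [add_mul, one_mul, ← Nat.div_div_eq_div_mul, Nat.div_mul_cancel hA.t_dvd]
  exact hA.v_eq

end IsHeffterArray

/-! ### The gluing data of a Heffter array, and the biembedding -/

section Data

variable {m n v lam t s k : ℕ} {J : AddSubgroup (ZMod v)} {A : PFArray m n (ZMod v)}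

/-- The faces: one for each translate of each row, and one for each translate of each column. -/
abbrev HeffterFace (m n v : ℕ) : Bool → Type
  | true => Fin m × ZMod v
  | false => Fin n × ZMod v

/-- The lengths of the two kinds of faces. -/
abbrev heffterLen (s k : ℕ) : Bool → ℕ
  | true => s
  | false => k

instance (s k : ℕ) [NeZero s] [NeZero k] (c : Bool) : NeZero (heffterLen s k c) := by
  cases c <;> infer_instance

/-- The powers of a full cycle, applied to a fixed element. -/
theorem bijective_pow_apply {B : Type} [Fintype B] {σ : Equiv.Perm B} (hσ : σ.IsCycleOn univ)
    (b : B) : Function.Bijective fun i : Fin (Fintype.card B) => (σ ^ (i : ℕ)) b := by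
  rw [Fintype.bijective_iff_surjective_and_card]
  refine ⟨fun b' => ?_, by simp⟩
  rw [← Finset.coe_univ] at hσ
  obtain ⟨i, hi, h⟩ := hσ.exists_pow_eq (Finset.mem_univ b) (Finset.mem_univ b')
  exact ⟨⟨i, hi⟩, h⟩

theorem pow_add_one_apply {B : Type} [Fintype B] [NeZero (Fintype.card B)] {σ : Equiv.Perm B}
    (hσ : σ.IsCycleOn univ) (b : B) (i : Fin (Fintype.card B)) :
    (σ ^ ((i + 1 : Fin (Fintype.card B)) : ℕ)) b = σ ((σ ^ (i : ℕ)) b) := by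
  rw [← Finset.coe_univ] at hσ
  rw [← Equiv.Perm.mul_apply, ← pow_succ', hσ.pow_apply_eq_pow_apply (Finset.mem_univ b),
    Finset.card_univ, Fin.val_add]
  simp [Nat.ModEq]

theorem Compatible.isCycleOn {ωr : LineOrdering A.row} {ωc : LineOrdering A.col}
    (h : Compatible ωr ωc) : (ωc.perm * ωr.perm).IsCycleOn univ := by
  have h1 : (ωc.perm * ωr.perm).support = Finset.univ := by
    rw [← Finset.card_eq_iff_eq_univ]
    exact h.2
  have h2 := h.1.isCycleOn
  have h3 : {x | (ωc.perm * ωr.perm) x ≠ x} = univ := by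
    rw [← Equiv.Perm.coe_support_eq_set_support, h1, Finset.coe_univ]
  rwa [h3] at h2

/-- The gluing data of the biembedding. -/
noncomputable def heffterData [NeZero s] [NeZero k] [NeZero v] [NeZero (Fintype.card A.Skel)]
    (hA : IsHeffterArray lam t s k J A) (ωr : LineOrdering A.row) (ωc : LineOrdering A.col)
    (hr : ωr.IsSimple A.entry s) (hc : ωc.IsSimple A.entry k) (hcomp : Compatible ωr ωc)
    (b : A.Skel) : CellData (ZMod v) (A.Skel × ZMod v) (HeffterFace m n v) (heffterLen s k)
      (Fintype.card A.Skel) where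
  src e := e.2
  tgt e := e.2 + A.entry e.1
  src_ne_tgt e h := hA.entry_notMem e.1 (by
    have : A.entry e.1 = 0 := by simpa using h
    rw [this]; exact J.zero_mem)
  next
    | true => ωr.inv.shift A.entry
    | false => ωc.shift A.entry
  src_next c e := by cases c <;> rfl
  faceEdge
    | true => ωr.inv.cycleEdgeEquiv A.entry (hasLength_of_card hA.row_filled)
    | false => ωc.cycleEdgeEquiv A.entry (hasLength_of_card hA.col_filled)
  faceEdge_succ
    | true => fun F j => ωr.inv.cycleEdgeEquiv_succ A.entry _
        (partialSum_eq_zero _ hA.row_filled hA.row_sum) F j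
    | false => fun F j => ωc.cycleEdgeEquiv_succ A.entry _
        (partialSum_eq_zero _ hA.col_filled hA.col_sum) F j
  src_faceEdge_injective
    | true => (hr.inv (hasLength_of_card hA.row_filled)
        (partialSum_eq_zero _ hA.row_filled hA.row_sum)).cycleEdgeEquiv_snd_injective _
    | false => hc.cycleEdgeEquiv_snd_injective _
  outEdge := (Equiv.prodComm _ _).trans
    ((Equiv.ofBijective _ (bijective_pow_apply hcomp.isCycleOn b)).prodCongr (Equiv.refl _))
  src_outEdge x i := rfl
  -- One step back along the reversed row leads from `(b, x)` to `(α_r b, x - a)`, with `a` the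
  -- entry of `α_r b`; one step forward along the column restores `x` and gives `(α_c (α_r b), x)`.
  outEdge_succ x i := by
    simp only [Equiv.trans_apply, Equiv.prodComm_apply, Prod.swap_prod_mk, Equiv.prodCongr_apply,
      Prod.map_apply, Equiv.ofBijective_apply, Equiv.refl_apply, LineOrdering.shift,
      LineOrdering.inv, Equiv.coe_fn_mk, Equiv.coe_fn_symm_mk, inv_inv, sub_add_cancel]
    rw [pow_add_one_apply hcomp.isCycleOn]
    rfl

/-- The edges of the gluing data are the edges of the multigraph `^λK`. -/
theorem nonempty_edgeLabelling [NeZero s] [NeZero k] [NeZero v] [NeZero (Fintype.card A.Skel)]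
    (hlam : lam ≠ 0)
    (hA : IsHeffterArray lam t s k J A) (ωr : LineOrdering A.row) (ωc : LineOrdering A.col)
    (hr : ωr.IsSimple A.entry s) (hc : ωc.IsSimple A.entry k) (hcomp : Compatible ωr ωc)
    (b : A.Skel) :
    Nonempty (EdgeLabelling (heffterData hA ωr ωc hr hc hcomp b) (cosetGraph J) lam) := by
  have hadj : ∀ e : A.Skel × ZMod v, (cosetGraph J).Adj e.2 (e.2 + A.entry e.1) := by
    intro e
    change e.2 - (e.2 + A.entry e.1) ∉ J
    simpa using hA.entry_notMem e.1
  -- The second component of `φ` chooses the parallel copy: the `λ` edges over a pair of vertices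
  -- receive distinct labels.
  obtain ⟨φ, hφ⟩ := exists_equiv_prod_fin (X := (cosetGraph J).edgeSet) hlam
    (fun e : A.Skel × ZMod v => ⟨s(e.2, e.2 + A.entry e.1), hadj e⟩) (by
      rintro ⟨ε, hε⟩
      induction ε using Sym2.ind with
      | _ x y =>
        rw [← hA.card_fiber (show x - y ∉ J from hε)]
        exact Nat.card_congr (Equiv.subtypeEquivRight fun e => Subtype.ext_iff))
  refine ⟨{ dart := fun e => (⟨(e.2, e.2 + A.entry e.1), hadj e⟩, (φ e).2)
            fst_dart := fun _ => rfl
            snd_dart := fun _ => rfl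
            existsUnique := ?_ }⟩
  intro d
  have key : ∀ e : A.Skel × ZMod v, (s(e.2, e.2 + A.entry e.1), (φ e).2) = (d.1.edge, d.2) ↔
      φ e = (⟨d.1.edge, d.1.edge_mem⟩, d.2) := by
    intro e
    rw [Prod.ext_iff, Prod.ext_iff, Subtype.ext_iff, hφ]
  refine ⟨φ.symm (⟨d.1.edge, d.1.edge_mem⟩, d.2), (key _).2 (by simp), fun e he => ?_⟩
  rw [← (key e).1 he, Equiv.symm_apply_apply]

end Data

end HeffterBiembedding

open HeffterBiembedding in
theorem mainTheorem6 {m n s k lam t v : ℕ} (J : AddSubgroup (ZMod v))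
    (A : PFArray m n (ZMod v)) (hA : IsHeffterArray lam t s k J A)
    (ωr : LineOrdering A.row) (ωc : LineOrdering A.col)
    (hr : ωr.IsSimple A.entry s) (hc : ωc.IsSimple A.entry k) (hcomp : Compatible ωr ωc) :
    Nonempty (cosetGraph J ≃g SimpleGraph.completeEquipartiteGraph (2 * n * k / (lam * t) + 1) t) ∧
    ∃ (D : Fin m × ZMod v → MultiCycle (cosetGraph J) lam s)
      (D' : Fin n × ZMod v → MultiCycle (cosetGraph J) lam k),
      (∀ p, (D p).vertex = ωr.inv.cycleVertices A.entry s p) ∧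
      (∀ p, (D' p).vertex = ωc.cycleVertices A.entry k p) ∧
      ∃ (S : Type) (_ : TopologicalSpace S) (ψ : Realization (cosetGraph J) lam → S),
        IsOrientableSurface S ∧ IsCellular ψ ∧ IsBiembedding ψ D D' := by
  -- A cycle moves some cell, so the array is not empty; the positivity of the parameters follows.
  obtain ⟨b, -⟩ := hcomp.1
  obtain ⟨-, hlam, ht, hv⟩ := hA.pos b
  have : NeZero v := ⟨hv.ne'⟩
  have hentry : ∀ b, A.entry b ≠ 0 := fun b h => hA.entry_notMem b (h ▸ J.zero_mem)
  have hs2 : 2 ≤ s := ωr.two_le_length A.entry (hasLength_of_card hA.row_filled)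
    (partialSum_eq_zero ωr hA.row_filled hA.row_sum (A.row b)) hentry
  have hk2 : 2 ≤ k := ωc.two_le_length A.entry (hasLength_of_card hA.col_filled)
    (partialSum_eq_zero ωc hA.col_filled hA.col_sum (A.col b)) hentry
  have : NeZero s := ⟨by omega⟩
  have : NeZero k := ⟨by omega⟩
  have : NeZero (Fintype.card A.Skel) := ⟨(Fintype.card_pos_iff.2 ⟨b⟩).ne'⟩
  refine ⟨nonempty_cosetGraph_iso J hA.card_J ?_, ?_⟩
  · rw [Nat.card_zmod]
    exact hA.card_zmod
  obtain ⟨L⟩ := nonempty_edgeLabelling hlam.ne' hA ωr ωc hr hc hcomp b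
  have hlen : ∀ c, 2 ≤ heffterLen s k c := by
    intro c
    cases c
    · exact hk2
    · exact hs2
  have := L.connectedSpace (connected_cosetGraph J (hA.entry_notMem b)) hlam
  refine ⟨L.faceCycle (hlen true), L.faceCycle (hlen false), fun p => ?_, fun p => ?_,
    (heffterData hA ωr ωc hr hc hcomp b).Surface, inferInstance, L.embed,
    (heffterData hA ωr ωc hr hc hcomp b).isOrientableSurface, L.isCellular_embed,
    L.isBiembedding (D := fun c => L.faceCycle (hlen c)) (fun _ _ _ => rfl)⟩
  · funext j
    exact L.fst_dart _
  · funext j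
    exact L.fst_dart _
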